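/- Let $X$ and $Y$ be coarse shape path connected topological spaces, i.e. for any two points $x_0,x_1$ of the space there is a bi-pointed coarse shape morphism from $(I,0,1)$ to the space with base points $x_0,x_1$. Suppose that $X$ and $Y$ have HPol-expansions $\mathbf p:X\to\mathbf X=(X_\lambda,p_{\lambda\lambda'},\Lambda)$ and $\mathbf q:Y\to\mathbf Y=(Y_\mu,q_{\mu\mu'},M)$ such that $\mathbf p\times\mathbf q:X\times Y\to\mathbf X\times\mathbf Y=(X_\lambda\times Y_\mu,\,p_{\lambda\lambda'}\times q_{\mu\mu'},\,\Lambda\times M)$ is an HPol-expansion of $X\times Y$. Here HPol is the full subcategory of the homotopy category HTop on the spaces having the homotopy type of a polyhedron, and HPol$_*$ is its pointed version. For a pointed space $(Z,z)$ and an integer $k\ge 1$, let $\check\pi_k^{*}(Z,z)$ be the set of pointed coarse shape morphisms $(S^k,*)\to(Z,z)$. Along an HPol$_*$-expansion $\mathbf r:(Z,z)\to((Z_\nu,z_\nu),r_{\nu\nu'},N)$ such a morphism is represented by a family of pointed homotopy classes $f^n_\nu:(S^k,*)\to(Z_\nu,z_\nu)$, $n\in\mathbb N$, $\nu\in N$,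 such that for all $\nu\le\nu'$ one has $r_{\nu\nu'}f^n_{\nu'}=f^n_\nu$ for all sufficiently large $n$; two families $(f^n_\nu)$, $(g^n_\nu)$ represent the same morphism iff for every $\nu$ one has $f^n_\nu=g^n_\nu$ for all sufficiently large $n$. The group operation is termwise concatenation. Let $\check\pi_k^{*^{top}}(Z,z)$ be this group with the topology that has as basis the sets $V_\nu^{F^*}=\{G^*: r_\nu\circ G^*=r_\nu\circ F^*\}$. Then for all $x\in X$, $y\in Y$ and all integers $k\ge1$ there is an isomorphism of topological groups $$\check\pi_k^{*^{top}}(X\times Y,(x,y))\;\cong\;\check\pi_k^{*^{top}}(X,x)\times\check\pi_k^{*^{top}}(Y,y),$$ whichever HPol$_*$-expansions of $(X\times Y,(x,y))$, $(X,x)$ and $(Y,y)$ are used to compute the three groups. -/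

import Mathlib

open CategoryTheory Set
open scoped unitInterval

universe u v w

noncomputable section

namespace CoarseShape

/-! ### Homotopy categories of spaces with marked points -/

/-- A topological space with marked points indexed by `A`. For `A = Empty` this is a plain space,
for `A = Unit` a pointed space, for `A = Bool` a bi-pointed space. -/
structure HTop (A : Type) : Type (u + 1) where
  carrier : Type u
  [top : TopologicalSpace carrier]
  pt : A → carrier

attribute [instance] HTop.top

namespace HTop

variable {A : Type}

/-- Continuous maps that respect the marked points. -/
def Map (X Y : HTop.{u} A) : Type u :=
  {f : C(X.carrier, Y.carrier) // ∀ a, f (X.pt a) = Y.pt a}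

/-- Homotopy keeping the marked points fixed. -/
instance mapSetoid (X Y : HTop.{u} A) : Setoid (Map X Y) where
  r f g := f.1.HomotopicRel g.1 (range X.pt)
  iseqv :=
    { refl := fun f => ContinuousMap.HomotopicRel.refl f.1
      symm := fun h => h.symm
      trans := fun h h' => h.trans h' }

/-- Composition of marked maps. -/
def Map.comp {X Y Z : HTop.{u} A} (f : Map X Y) (g : Map Y Z) : Map X Z :=
  ⟨g.1.comp f.1, fun a => by simp [f.2 a, g.2 a]⟩

theorem Map.comp_congr {X Y Z : HTop.{u} A} {f f' : Map X Y} (hf : f ≈ f') {g g' : Map Y Z}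
    (hg : g ≈ g') : f.comp g ≈ f'.comp g' := by
  obtain ⟨F⟩ := hf
  obtain ⟨G⟩ := hg
  refine ⟨⟨G.toHomotopy.comp F.toHomotopy, ?_⟩⟩
  rintro t _ ⟨a, rfl⟩
  have hF : F (t, X.pt a) = Y.pt a := (F.eq_fst t ⟨a, rfl⟩).trans (f.2 a)
  have hG : G (t, Y.pt a) = Z.pt a := (G.eq_fst t ⟨a, rfl⟩).trans (g.2 a)
  change G (t, F (t, X.pt a)) = g.1 (f.1 (X.pt a))
  rw [hF, hG, f.2 a, g.2 a]

/-- The homotopy category: objects are marked spaces, morphisms are homotopy classes, relative to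
the marked points, of marked maps. -/
instance category : Category.{u} (HTop.{u} A) where
  Hom X Y := Quotient (mapSetoid X Y)
  id X := ⟦⟨ContinuousMap.id _, fun _ => rfl⟩⟧
  comp f g := Quotient.map₂ Map.comp (fun _ _ hf _ _ hg => Map.comp_congr hf hg) f g
  id_comp f := by
    induction f using Quotient.inductionOn
    rfl
  comp_id f := by
    induction f using Quotient.inductionOn
    rfl
  assoc f g h := by
    induction f using Quotient.inductionOn
    induction g using Quotient.inductionOn
    induction h using Quotient.inductionOn
    rfl

/-- The homotopy class of a marked map. -/
def toHom {X Y : HTop.{u} A} (f : Map X Y) : X ⟶ Y := Quotient.mk (mapSetoid X Y) f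

theorem exists_rep {X Y : HTop.{u} A} (f : X ⟶ Y) : ∃ f' : Map X Y, toHom f' = f :=
  Quotient.exists_rep f

/-- The product of two marked spaces. -/
def prod (X Y : HTop.{u} A) : HTop.{u} A where
  carrier := X.carrier × Y.carrier
  pt a := (X.pt a, Y.pt a)

/-- The product of two marked maps. -/
def Map.prod {X X' Y Y' : HTop.{u} A} (f : Map X X') (g : Map Y Y') :
    Map (X.prod Y) (X'.prod Y') :=
  ⟨f.1.prodMap g.1, fun a => Prod.ext (f.2 a) (g.2 a)⟩

theorem Map.prod_congr {X X' Y Y' : HTop.{u} A} {f f' : Map X X'} (hf : f ≈ f')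
    {g g' : Map Y Y'} (hg : g ≈ g') : f.prod g ≈ f'.prod g' := by
  obtain ⟨F⟩ := hf
  obtain ⟨G⟩ := hg
  refine ⟨⟨F.toHomotopy.prodMap G.toHomotopy, ?_⟩⟩
  rintro t _ ⟨a, rfl⟩
  exact Prod.ext (F.eq_fst t ⟨a, rfl⟩) (G.eq_fst t ⟨a, rfl⟩)

/-- The product of two homotopy classes. -/
def prodHom {X X' Y Y' : HTop.{u} A} (f : X ⟶ X') (g : Y ⟶ Y') : X.prod Y ⟶ X'.prod Y' :=
  Quotient.map₂ Map.prod (fun _ _ hf _ _ hg => Map.prod_congr hf hg) f g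

theorem prodHom_id (X Y : HTop.{u} A) : prodHom (𝟙 X) (𝟙 Y) = 𝟙 (X.prod Y) := rfl

theorem prodHom_comp {X X' X'' Y Y' Y'' : HTop.{u} A} (f : X ⟶ X') (f' : X' ⟶ X'')
    (g : Y ⟶ Y') (g' : Y' ⟶ Y'') :
    prodHom f g ≫ prodHom f' g' = prodHom (f ≫ f') (g ≫ g') := by
  induction f using Quotient.inductionOn
  induction f' using Quotient.inductionOn
  induction g using Quotient.inductionOn
  induction g' using Quotient.inductionOn
  rfl

/-- A plain topological space. -/
def space (X : Type u) [TopologicalSpace X] : HTop.{u} Empty := ⟨X, Empty.elim⟩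

/-- The pointed space `(X, x)`. -/
def pointed (X : Type u) [TopologicalSpace X] (x : X) : HTop.{u} Unit := ⟨X, fun _ => x⟩

/-- The bi-pointed space `(X, x₀, x₁)`. -/
def bipointed (X : Type u) [TopologicalSpace X] (x₀ x₁ : X) : HTop.{u} Bool :=
  ⟨X, fun b => bif b then x₁ else x₀⟩

end HTop

/-! ### Polyhedra -/

/-- The geometric realization of an abstract simplicial complex, in barycentric coordinates. -/
def Realization {V : Type u} (K : AbstractSimplicialComplex V) : Type u :=
  {t : V →₀ ℝ // t.support ∈ K.faces ∧ (∀ v, 0 ≤ t v) ∧ t.sum (fun _ a => a) = 1}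

/-- The closed simplex of the realization spanned by a finite set of vertices. -/
def ClosedSimplex {V : Type u} (K : AbstractSimplicialComplex V) (s : Finset V) : Type u :=
  {t : Realization K // t.1.support ⊆ s}

/-- A closed simplex has the Euclidean topology given by its barycentric coordinates. -/
instance {V : Type u} (K : AbstractSimplicialComplex V) (s : Finset V) :
    TopologicalSpace (ClosedSimplex K s) :=
  TopologicalSpace.induced (fun t v => t.1.1 v) (inferInstance : TopologicalSpace (V → ℝ))

/-- The weak topology: a set is open iff it meets every closed simplex in an open set. -/
instance {V : Type u} (K : AbstractSimplicialComplex V) : TopologicalSpace (Realization K) :=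
  ⨆ s ∈ K.faces, TopologicalSpace.coinduced (fun t : ClosedSimplex K s => t.1) inferInstance

/-- The objects of HPol (for `A = Empty`), of HPol_* (for `A = Unit`) and of the bi-pointed version
(for `A = Bool`): marked spaces with the homotopy type of a polyhedron with marked points. -/
def IsHPol {A : Type} (X : HTop.{u} A) : Prop :=
  ∃ (V : Type u) (K : AbstractSimplicialComplex V) (b : A → Realization K),
    Nonempty (X ≅ (⟨Realization K, b⟩ : HTop.{u} A))

/-! ### Inverse systems, pro*-morphisms, expansions -/

section Systems

variable {C : Type v} [Category.{w} C]

/-- An inverse system in the category `C`, indexed by a directed set. -/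
structure InvSys (C : Type v) [Category.{w} C] : Type (max v w (u + 1)) where
  Idx : Type u
  [preorder : Preorder Idx]
  [directed : IsDirectedOrder Idx]
  [nonempty : Nonempty Idx]
  obj : Idx → C
  bond : ∀ {i j : Idx}, i ≤ j → (obj j ⟶ obj i)
  bond_refl : ∀ i, bond (le_refl i) = 𝟙 (obj i)
  bond_comp : ∀ {i j k : Idx} (hij : i ≤ j) (hjk : j ≤ k),
    bond hjk ≫ bond hij = bond (hij.trans hjk)

attribute [instance] InvSys.preorder InvSys.directed InvSys.nonempty

/-- The rudimentary inverse system consisting of a single object. -/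
def rud (X : C) : InvSys.{u} C where
  Idx := PUnit.{u + 1}
  obj _ := X
  bond _ := 𝟙 X
  bond_refl _ := rfl
  bond_comp _ _ := Category.comp_id _

/-- An S*-morphism of inverse systems. -/
structure SStarMor (S T : InvSys.{u} C) where
  idx : T.Idx → S.Idx
  map : ℕ → ∀ μ : T.Idx, S.obj (idx μ) ⟶ T.obj μ
  compat : ∀ {μ μ' : T.Idx} (h : μ ≤ μ'), ∃ (l : S.Idx) (h₁ : idx μ ≤ l) (h₂ : idx μ' ≤ l) (n : ℕ),
    ∀ n' ≥ n, S.bond h₂ ≫ map n' μ' ≫ T.bond h = S.bond h₁ ≫ map n' μ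

/-- Equivalence of S*-morphisms. -/
instance SStarMor.setoid (S T : InvSys.{u} C) : Setoid (SStarMor S T) where
  r f g := ∀ μ, ∃ (l : S.Idx) (h₁ : f.idx μ ≤ l) (h₂ : g.idx μ ≤ l) (n : ℕ),
    ∀ n' ≥ n, S.bond h₁ ≫ f.map n' μ = S.bond h₂ ≫ g.map n' μ
  iseqv :=
    { refl := fun f μ => ⟨f.idx μ, le_rfl, le_rfl, 0, fun _ _ => rfl⟩
      symm := fun h μ => by
        obtain ⟨l, h₁, h₂, n, hn⟩ := h μ
        exact ⟨l, h₂, h₁, n, fun n' hn' => (hn n' hn').symm⟩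
      trans := fun {f g k} h h' μ => by
        obtain ⟨l, h₁, h₂, n, hn⟩ := h μ
        obtain ⟨l', h₁', h₂', n₂, hn₂⟩ := h' μ
        obtain ⟨m, hm, hm'⟩ := exists_ge_ge l l'
        refine ⟨m, h₁.trans hm, h₂'.trans hm', max n n₂, fun n' hn' => ?_⟩
        rw [← S.bond_comp h₁ hm, Category.assoc, hn n' (le_of_max_le_left hn'),
          ← Category.assoc, S.bond_comp, ← S.bond_comp h₂' hm', Category.assoc,
          ← hn₂ n' (le_of_max_le_right hn'), ← Category.assoc, S.bond_comp] }

/-- Morphisms of pro*-`C`: equivalence classes of S*-morphisms. -/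
def ProStar (S T : InvSys.{u} C) : Type _ := Quotient (SStarMor.setoid S T)

/-- The composite of an S*-morphism with the projection of its target system to the `μ`-th term. -/
def SStarMor.proj {S T : InvSys.{u} C} (f : SStarMor S T) (μ : T.Idx) :
    SStarMor S (rud (T.obj μ)) where
  idx _ := f.idx μ
  map n _ := f.map n μ
  compat _ := ⟨f.idx μ, le_rfl, le_rfl, 0, fun _ _ =>
    congrArg (S.bond le_rfl ≫ ·) (Category.comp_id _)⟩

/-- The composite of a morphism of pro*-`C` with the projection of its target system to the `μ`-th
term. -/
def ProStar.proj {S T : InvSys.{u} C} (μ : T.Idx) (F : ProStar S T) :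
    ProStar S (rud (T.obj μ)) :=
  Quotient.map (sa := SStarMor.setoid S T) (sb := SStarMor.setoid S (rud (T.obj μ)))
    (fun f => f.proj μ)
    (fun f g (h : ∀ μ, ∃ (l : S.Idx) (h₁ : f.idx μ ≤ l) (h₂ : g.idx μ ≤ l) (n : ℕ),
      ∀ n' ≥ n, S.bond h₁ ≫ f.map n' μ = S.bond h₂ ≫ g.map n' μ) _ => h μ) F

/-- A morphism of pro-`C` from an object (a rudimentary system) to an inverse system. -/
structure ToSys (X : C) (S : InvSys.{u} C) where
  proj : ∀ l, X ⟶ S.obj l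
  proj_bond : ∀ {l l' : S.Idx} (h : l ≤ l'), proj l' ≫ S.bond h = proj l

/-- `p : X ⟶ S` is an expansion with respect to the full subcategory of `C` on the objects that
satisfy `IsP`. -/
structure IsExpansion (IsP : C → Prop) {X : C} {S : InvSys.{u} C} (p : ToSys X S) : Prop where
  mem : ∀ l, IsP (S.obj l)
  e1 : ∀ P : C, IsP P → ∀ h : X ⟶ P, ∃ (l : S.Idx) (f : S.obj l ⟶ P), p.proj l ≫ f = h
  e2 : ∀ P : C, IsP P → ∀ (l : S.Idx) (f₀ f₁ : S.obj l ⟶ P), p.proj l ≫ f₀ = p.proj l ≫ f₁ →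
    ∃ (l' : S.Idx) (h : l ≤ l'), S.bond h ≫ f₀ = S.bond h ≫ f₁

end Systems

/-- An HPol-expansion of a space, an HPol_*-expansion of a pointed space, or the bi-pointed
version. -/
def IsHPolExpansion {A : Type} {X : HTop.{u} A} {S : InvSys.{u} (HTop.{u} A)} (p : ToSys X S) :
    Prop :=
  IsExpansion IsHPol p

/-- The product of two inverse systems, with index set the product of the index sets. -/
def InvSys.prod {A : Type} (S T : InvSys.{u} (HTop.{u} A)) : InvSys.{u} (HTop.{u} A) where
  Idx := S.Idx × T.Idx
  directed := ⟨fun a b => by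
    obtain ⟨c, hc, hc'⟩ := exists_ge_ge a.1 b.1
    obtain ⟨d, hd, hd'⟩ := exists_ge_ge a.2 b.2
    exact ⟨(c, d), ⟨hc, hd⟩, ⟨hc', hd'⟩⟩⟩
  obj i := (S.obj i.1).prod (T.obj i.2)
  bond {i j} (h : i ≤ j) := HTop.prodHom (S.bond (Prod.le_def.1 h).1) (T.bond (Prod.le_def.1 h).2)
  bond_refl i := by rw [S.bond_refl, T.bond_refl, HTop.prodHom_id]
  bond_comp hij hjk := by rw [HTop.prodHom_comp, S.bond_comp, T.bond_comp]

/-- The product `p × q`. -/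
def ToSys.prod {A : Type} {X Y : HTop.{u} A} {S T : InvSys.{u} (HTop.{u} A)} (p : ToSys X S)
    (q : ToSys Y T) : ToSys (X.prod Y) (S.prod T) where
  proj i := HTop.prodHom (p.proj i.1) (q.proj i.2)
  proj_bond h := (HTop.prodHom_comp _ _ _ _).trans (by rw [p.proj_bond, q.proj_bond])

/-! ### Coarse shape paths -/

/-- The bi-pointed unit interval `(I, 0, 1)`. -/
def interval : HTop.{u} Bool := HTop.bipointed (ULift.{u} I) ⟨0⟩ ⟨1⟩

/-- Any two points are joined by a coarse shape path, that is, by a bi-pointed coarse shape morphism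
from `(I, 0, 1)`; such a morphism is represented, along some expansion, by a pro*-morphism. -/
def CoarseShapePathConnected (X : Type u) [TopologicalSpace X] : Prop :=
  ∀ x₀ x₁ : X, ∃ (S : InvSys.{u} (HTop.{u} Bool)) (p : ToSys (HTop.bipointed X x₀ x₁) S),
    IsHPolExpansion p ∧ Nonempty (ProStar (rud interval) S)

/-! ### The sphere and homotopy groups -/

/-- The equivalence relation collapsing the boundary of the cube to a point. -/
def cubeSetoid (k : ℕ) : Setoid (Fin k → I) where
  r a b := a = b ∨ (a ∈ Cube.boundary (Fin k) ∧ b ∈ Cube.boundary (Fin k))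
  iseqv :=
    { refl := fun _ => Or.inl rfl
      symm := by
        rintro _ _ (rfl | ⟨h, h'⟩)
        · exact Or.inl rfl
        · exact Or.inr ⟨h', h⟩
      trans := by
        rintro _ _ _ (rfl | ⟨h, h'⟩) (rfl | ⟨g, g'⟩)
        · exact Or.inl rfl
        · exact Or.inr ⟨g, g'⟩
        · exact Or.inr ⟨h, h'⟩
        · exact Or.inr ⟨h, g'⟩ }

/-- The `k`-sphere, `k ≥ 1`, as the `k`-cube with its boundary collapsed to a point. -/
def CubeSphere (k : ℕ) : Type := Quotient (cubeSetoid k)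

instance (k : ℕ) : TopologicalSpace (CubeSphere k) :=
  inferInstanceAs (TopologicalSpace (Quotient (cubeSetoid k)))

/-- The quotient map from the cube to the sphere. -/
def CubeSphere.mk (k : ℕ) : C(Fin k → I, CubeSphere k) :=
  ⟨Quotient.mk (cubeSetoid k), continuous_quotient_mk'⟩

theorem CubeSphere.zero_mem_boundary (k : ℕ) [NeZero k] :
    (0 : Fin k → I) ∈ Cube.boundary (Fin k) :=
  ⟨0, Or.inl rfl⟩

/-- The pointed sphere `(S^k, *)`, whose base point is the class of the boundary. -/
def sphere (k : ℕ) : HTop.{u} Unit :=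
  HTop.pointed (ULift.{u} (CubeSphere k)) ⟨CubeSphere.mk k 0⟩

section SphereMaps

variable {k : ℕ} [NeZero k] {P Q : HTop.{u} Unit}

/-- A pointed map from the sphere, viewed as a map of the cube. -/
def toGenLoop (f : HTop.Map (sphere.{u} k) P) : GenLoop (Fin k) P.carrier (P.pt ()) :=
  ⟨(f.1.comp ⟨ULift.up, continuous_uliftUp⟩).comp (CubeSphere.mk k), fun y hy => by
    have h : CubeSphere.mk k y = CubeSphere.mk k 0 :=
      Quotient.sound (Or.inr ⟨hy, CubeSphere.zero_mem_boundary k⟩)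
    change f.1 ⟨CubeSphere.mk k y⟩ = _
    rw [h]
    exact f.2 ()⟩

/-- A map of the cube, constant on the boundary, descends to the sphere. -/
def descend {Z : Type u} [TopologicalSpace Z] (g : C(Fin k → I, Z)) (z : Z)
    (hg : ∀ y ∈ Cube.boundary (Fin k), g y = z) : C(ULift.{u} (CubeSphere k), Z) where
  toFun s := Quotient.lift (s := cubeSetoid k) g (by
    rintro a b (rfl | ⟨ha, hb⟩)
    · rfl
    · rw [hg a ha, hg b hb]) s.down
  continuous_toFun := by
    have h := Continuous.quotient_lift (s := cubeSetoid k) g.continuous (by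
      rintro a b (rfl | ⟨ha, hb⟩)
      · rfl
      · rw [hg a ha, hg b hb])
    exact h.comp continuous_uliftDown

/-- A map of the cube sending the boundary to the base point, viewed as a map of the sphere. -/
def ofGenLoop (g : GenLoop (Fin k) P.carrier (P.pt ())) : HTop.Map (sphere.{u} k) P :=
  ⟨descend g.1 (P.pt ()) g.2, fun _ => g.2 0 (CubeSphere.zero_mem_boundary k)⟩

theorem toGenLoop_congr {f f' : HTop.Map (sphere.{u} k) P} (h : f ≈ f') :
    GenLoop.Homotopic (toGenLoop f) (toGenLoop f') := by
  obtain ⟨F⟩ := h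
  refine ⟨⟨⟨⟨fun z => F (z.1, ⟨CubeSphere.mk k z.2⟩), ?_⟩, ?_, ?_⟩, ?_⟩⟩
  · exact F.continuous.comp (continuous_fst.prodMk
      (continuous_uliftUp.comp ((CubeSphere.mk k).continuous.comp continuous_snd)))
  · exact fun y => F.apply_zero _
  · exact fun y => F.apply_one _
  · intro t y hy
    have h : CubeSphere.mk k y = CubeSphere.mk k 0 :=
      Quotient.sound (Or.inr ⟨hy, CubeSphere.zero_mem_boundary k⟩)
    change F (t, ⟨CubeSphere.mk k y⟩) = f.1 ⟨CubeSphere.mk k y⟩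
    rw [h]
    exact F.eq_fst t ⟨(), rfl⟩

theorem ofGenLoop_congr {g g' : GenLoop (Fin k) P.carrier (P.pt ())}
    (h : GenLoop.Homotopic g g') : ofGenLoop g ≈ ofGenLoop g' := by
  obtain ⟨G⟩ := h
  let G' : C(Fin k → I, C(I, P.carrier)) :=
    ContinuousMap.curry ⟨fun z => G (z.2, z.1), G.continuous.comp continuous_swap⟩
  have hG' : ∀ y ∈ Cube.boundary (Fin k), G' y = ContinuousMap.const I (P.pt ()) := by
    intro y hy
    ext t
    exact (G.eq_fst t hy).trans (g.2 y hy)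
  let D : C(ULift.{u} (CubeSphere k), C(I, P.carrier)) := descend G' _ hG'
  refine ⟨⟨⟨⟨fun z => D z.2 z.1, ?_⟩, ?_, ?_⟩, ?_⟩⟩
  · exact (ContinuousMap.continuous_uncurry_of_continuous D).comp continuous_swap
  · rintro ⟨s⟩
    obtain ⟨y, rfl⟩ := Quotient.exists_rep s
    exact G.apply_zero y
  · rintro ⟨s⟩
    obtain ⟨y, rfl⟩ := Quotient.exists_rep s
    exact G.apply_one y
  · rintro t _ ⟨a, rfl⟩
    exact G.eq_fst t (CubeSphere.zero_mem_boundary k)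
/-- Morphisms from the pointed sphere in the pointed homotopy category are the elements of the
homotopy group. -/
def sphereHomEquiv : (sphere.{u} k ⟶ P) ≃ HomotopyGroup (Fin k) P.carrier (P.pt ()) where
  toFun := Quotient.map toGenLoop fun _ _ h => toGenLoop_congr h
  invFun := Quotient.map ofGenLoop fun _ _ h => ofGenLoop_congr h
  left_inv f := by
    induction f using Quotient.inductionOn with
    | h f =>
      refine congrArg (Quotient.mk _) (Subtype.ext (ContinuousMap.ext ?_))
      rintro ⟨s⟩
      induction s using Quotient.inductionOn
      rfl
  right_inv g := by
    induction g using Quotient.inductionOn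
    rfl

/-- The group structure on `[(S^k, *), P]`: the product of `a` and `b` is the concatenation of `a`
followed by `b`. (Mathlib's product on `HomotopyGroup` has the opposite order.) -/
instance sphereHomGroup : Group (sphere.{u} k ⟶ P) :=
  ((sphereHomEquiv (k := k) (P := P)).trans MulOpposite.opEquiv).group

theorem sphereHom_mul_mk (i : Fin k) (f g : HTop.Map (sphere.{u} k) P) :
    HTop.toHom f * HTop.toHom g =
      HTop.toHom (ofGenLoop (GenLoop.transAt i (toGenLoop f) (toGenLoop g))) := by
  change sphereHomEquiv.symm (sphereHomEquiv (HTop.toHom g) * sphereHomEquiv (HTop.toHom f)) = _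
  exact congrArg sphereHomEquiv.symm (HomotopyGroup.mul_spec (i := i))

theorem sphereHom_mul_comp (a b : sphere.{u} k ⟶ P) (g : P ⟶ Q) :
    (a * b) ≫ g = (a ≫ g) * (b ≫ g) := by
  obtain ⟨a, rfl⟩ := HTop.exists_rep a
  obtain ⟨b, rfl⟩ := HTop.exists_rep b
  obtain ⟨g, rfl⟩ := HTop.exists_rep g
  refine Eq.trans ?_ (sphereHom_mul_mk 0 (a.comp g) (b.comp g)).symm
  rw [sphereHom_mul_mk 0 a b]
  refine congrArg (Quotient.mk _) (Subtype.ext (ContinuousMap.ext ?_))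
  rintro ⟨s⟩
  obtain ⟨y, rfl⟩ := Quotient.exists_rep s
  change g.1 (GenLoop.transAt 0 (toGenLoop a) (toGenLoop b) y) =
    GenLoop.transAt 0 (toGenLoop (a.comp g)) (toGenLoop (b.comp g)) y
  simp only [GenLoop.transAt, GenLoop.coe_copy]
  split_ifs <;> rfl

theorem sphereHom_one_comp (g : P ⟶ Q) : (1 : sphere.{u} k ⟶ P) ≫ g = 1 := by
  have h := sphereHom_mul_comp (1 : sphere.{u} k ⟶ P) 1 g
  rw [mul_one] at h
  exact left_eq_mul.1 h

theorem sphereHom_inv_comp (a : sphere.{u} k ⟶ P) (g : P ⟶ Q) : a⁻¹ ≫ g = (a ≫ g)⁻¹ := by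
  refine eq_inv_of_mul_eq_one_left ?_
  rw [← sphereHom_mul_comp, inv_mul_cancel, sphereHom_one_comp]

end SphereMaps

/-! ### The topological coarse shape homotopy groups -/

section CoarseHomotopyGroup

variable (k : ℕ) [NeZero k] {X : HTop.{u} Unit} {S : InvSys.{u} (HTop.{u} Unit)}

/-- The `k`-th coarse shape homotopy group of the pointed space `X`, that is, the set of coarse
shape morphisms from `(S^k, *)` to `X`, represented along the HPol_*-expansion `p : X ⟶ S` (and the
identity expansion of the sphere). -/
def CoarseHomotopyGroup (_p : ToSys X S) : Type u := ProStar (rud (sphere.{u} k)) S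

namespace CoarseHomotopyGroup

variable {k}

/-- The morphism at stage `n` and index `μ` of an S*-morphism from the sphere. -/
def term (f : SStarMor (rud (sphere.{u} k)) S) (n : ℕ) (μ : S.Idx) : sphere.{u} k ⟶ S.obj μ :=
  f.map n μ

theorem term_compat (f : SStarMor (rud (sphere.{u} k)) S) {μ μ' : S.Idx} (h : μ ≤ μ') :
    ∃ n, ∀ n' ≥ n, term f n' μ' ≫ S.bond h = term f n' μ := by
  obtain ⟨_, _, _, n, hn⟩ := f.compat h
  exact ⟨n, fun n' hn' => (Category.id_comp _).symm.trans
    ((hn n' hn').trans (Category.id_comp _))⟩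

theorem equiv_iff (f g : SStarMor (rud (sphere.{u} k)) S) :
    f ≈ g ↔ ∀ μ, ∃ n, ∀ n' ≥ n, term f n' μ = term g n' μ := by
  constructor
  · intro h μ
    obtain ⟨_, _, _, n, hn⟩ := h μ
    exact ⟨n, fun n' hn' => (Category.id_comp _).symm.trans
      ((hn n' hn').trans (Category.id_comp _))⟩
  · intro h μ
    obtain ⟨n, hn⟩ := h μ
    exact ⟨PUnit.unit, le_rfl, le_rfl, n, fun n' hn' => (Category.id_comp _).trans
      ((hn n' hn').trans (Category.id_comp _).symm)⟩

/-- The S*-morphism with given terms. -/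
def ofTerms (t : ℕ → ∀ μ : S.Idx, sphere.{u} k ⟶ S.obj μ)
    (ht : ∀ {μ μ' : S.Idx} (h : μ ≤ μ'), ∃ n, ∀ n' ≥ n, t n' μ' ≫ S.bond h = t n' μ) :
    SStarMor (rud (sphere.{u} k)) S where
  idx _ := PUnit.unit
  map := t
  compat h := by
    obtain ⟨n, hn⟩ := ht h
    exact ⟨PUnit.unit, le_rfl, le_rfl, n, fun n' hn' => (Category.id_comp _).trans
      ((hn n' hn').trans (Category.id_comp _).symm)⟩

/-- Termwise product of S*-morphisms from the sphere. -/
def mulMor (f g : SStarMor (rud (sphere.{u} k)) S) : SStarMor (rud (sphere.{u} k)) S :=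
  ofTerms (fun n μ => term f n μ * term g n μ) fun h => by
    obtain ⟨n, hn⟩ := term_compat f h
    obtain ⟨m, hm⟩ := term_compat g h
    refine ⟨max n m, fun n' hn' => ?_⟩
    rw [sphereHom_mul_comp, hn n' (le_of_max_le_left hn'), hm n' (le_of_max_le_right hn')]

/-- Termwise inverse of an S*-morphism from the sphere. -/
def invMor (f : SStarMor (rud (sphere.{u} k)) S) : SStarMor (rud (sphere.{u} k)) S :=
  ofTerms (fun n μ => (term f n μ)⁻¹) fun h => by
    obtain ⟨n, hn⟩ := term_compat f h
    exact ⟨n, fun n' hn' => by rw [sphereHom_inv_comp, hn n' hn']⟩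

/-- The trivial S*-morphism from the sphere. -/
def oneMor : SStarMor (rud (sphere.{u} k)) S :=
  ofTerms (fun _ _ => 1) fun _ => ⟨0, fun _ _ => sphereHom_one_comp _⟩

variable (p : ToSys X S)

instance : Mul (CoarseHomotopyGroup k p) where
  mul := Quotient.map₂ (sa := SStarMor.setoid _ _) (sb := SStarMor.setoid _ _)
    (sc := SStarMor.setoid _ _) mulMor fun f f' hf g g' hg => (equiv_iff _ _).2 fun μ => by
      obtain ⟨n, hn⟩ := (equiv_iff _ _).1 hf μ
      obtain ⟨m, hm⟩ := (equiv_iff _ _).1 hg μ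
      refine ⟨max n m, fun n' hn' => ?_⟩
      change term f n' μ * term g n' μ = term f' n' μ * term g' n' μ
      rw [hn n' (le_of_max_le_left hn'), hm n' (le_of_max_le_right hn')]

instance : Inv (CoarseHomotopyGroup k p) where
  inv := Quotient.map (sa := SStarMor.setoid _ _) (sb := SStarMor.setoid _ _) invMor
    fun f f' hf => (equiv_iff _ _).2 fun μ => by
      obtain ⟨n, hn⟩ := (equiv_iff _ _).1 hf μ
      refine ⟨n, fun n' hn' => ?_⟩
      change (term f n' μ)⁻¹ = (term f' n' μ)⁻¹
      rw [hn n' hn']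

instance : One (CoarseHomotopyGroup k p) where
  one := Quotient.mk (SStarMor.setoid _ _) oneMor

/-- The group structure: termwise concatenation. -/
instance : Group (CoarseHomotopyGroup k p) where
  mul_assoc a b c := by
    obtain ⟨a, rfl⟩ := Quotient.exists_rep a
    obtain ⟨b, rfl⟩ := Quotient.exists_rep b
    obtain ⟨c, rfl⟩ := Quotient.exists_rep c
    exact Quotient.sound ((equiv_iff _ _).2 fun μ => ⟨0, fun n _ =>
      mul_assoc (term a n μ) (term b n μ) (term c n μ)⟩)
  one_mul a := by
    obtain ⟨a, rfl⟩ := Quotient.exists_rep a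
    exact Quotient.sound ((equiv_iff _ _).2 fun μ => ⟨0, fun n _ => one_mul (term a n μ)⟩)
  mul_one a := by
    obtain ⟨a, rfl⟩ := Quotient.exists_rep a
    exact Quotient.sound ((equiv_iff _ _).2 fun μ => ⟨0, fun n _ => mul_one (term a n μ)⟩)
  inv_mul_cancel a := by
    obtain ⟨a, rfl⟩ := Quotient.exists_rep a
    exact Quotient.sound ((equiv_iff _ _).2 fun μ => ⟨0, fun n _ => inv_mul_cancel (term a n μ)⟩)

/-- The basic neighbourhood of `F` at the index `μ`: all `G` with `p_μ ∘ G = p_μ ∘ F`. -/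
def nbhd (F : CoarseHomotopyGroup k p) (μ : S.Idx) : Set (CoarseHomotopyGroup k p) :=
  {G | ProStar.proj μ F = ProStar.proj μ G}

/-- The topology on the coarse shape homotopy group, with basis the sets `nbhd p F μ`. -/
instance : TopologicalSpace (CoarseHomotopyGroup k p) :=
  TopologicalSpace.generateFrom {U | ∃ F μ, U = nbhd p F μ}

end CoarseHomotopyGroup

end CoarseHomotopyGroup

end CoarseShape

end

noncomputable section

namespace CoarseShape

/-! ### The `ℓ¹`-norm on finitely supported functions -/

/-! The two projections induce a continuous homomorphism `Φ` to the product group, and the product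
of the maps induced by the two inclusions at the base points is a continuous right inverse `Ψ`. The
product expansion is needed only for the injectivity of `Φ`.

That expansion is unpointed, while the groups are pointed. But injectivity of a homomorphism is a
statement about its kernel, and there base points do no harm: a pointed sphere map that is freely
null-homotopic is null-homotopic as a pointed map (`sphereHom_eq_one_of_free`). So free
factorizations suffice. By (E1) for the product expansion, each term of the expansion `r` of the
product factors freely through a product of unpointed terms, hence through a product of terms of `p`
and `q`, once pointed expansions are known to be unpointed expansions too. By (E2) some bonding map
of `r` factors in the same way, so it kills every element that is trivial in both factors
(`exists_bond_eq_one`).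

The hard point is (E2) in `IsHPolExpansion.free`. A free homotopy drags the base point along a path,
and the base point of an arbitrary space need not be cofibred, so the homotopy cannot be corrected
on the source. The target is deformed instead: a self-map of the polyhedron, homotopic to the
identity, undoes the path (`exists_slide`). In the `ℓ¹`-metric, close points are joined by paths
that depend continuously on both ends (`push`), which settles short paths; connectedness of the
interval does the rest. The weak topology is reached through `toWeak_comp_toMetric_homotopic`.

The groups themselves are treated as inverse limits of groups of germs at infinity, with the initial
topology for the maps to these groups taken as discrete. A map into an object of HPol_* factors
through a term of the expansion and so acts on germs (`eval`, `induced`). -/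

/-- Finitely supported real functions, with the `ℓ¹`-norm. -/
def FinL1 (V : Type u) : Type u := V →₀ ℝ

namespace FinL1

variable {V : Type u}

/-- The underlying finitely supported function. -/
def val (f : FinL1 V) : V →₀ ℝ := f

/-- The sum of the absolute values. -/
def absSum (f : V →₀ ℝ) : ℝ := f.sum fun _ a => |a|

theorem absSum_eq {f : V →₀ ℝ} {s : Finset V} (h : f.support ⊆ s) :
    absSum f = ∑ v ∈ s, |f v| :=
  Finsupp.sum_of_support_subset _ h _ fun _ _ => abs_zero

theorem absSum_nonneg (f : V →₀ ℝ) : 0 ≤ absSum f :=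
  Finset.sum_nonneg fun _ _ => abs_nonneg _

theorem abs_le_absSum (f : V →₀ ℝ) (v : V) : |f v| ≤ absSum f := by
  by_cases h : v ∈ f.support
  · exact Finset.single_le_sum (f := fun v => |f v|) (fun _ _ => abs_nonneg _) h
  · rw [Finsupp.notMem_support_iff.1 h, abs_zero]
    exact absSum_nonneg f

/-- Serves both for the triangle inequality and for the Lipschitz bound on the pointwise minimum. -/
theorem absSum_le_add {f g h : V →₀ ℝ} (H : ∀ v, |f v| ≤ |g v| + |h v|) :
    absSum f ≤ absSum g + absSum h := by
  classical
  rw [absSum_eq (f := f) (s := f.support ∪ g.support ∪ h.support) (by grind),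
    absSum_eq (f := g) (s := f.support ∪ g.support ∪ h.support) (by grind),
    absSum_eq (f := h) (s := f.support ∪ g.support ∪ h.support) (by grind),
    ← Finset.sum_add_distrib]
  exact Finset.sum_le_sum fun v _ => H v

/-- The `ℓ¹`-norm. -/
def l1Norm (V : Type u) : AddGroupNorm (V →₀ ℝ) where
  toFun f := absSum f
  map_zero' := Finset.sum_empty (f := fun _ : V => |(0 : ℝ)|)
  add_le' f g := absSum_le_add fun v => abs_add_le (f v) (g v)
  neg' f := by
    have h (v : V) : |(-f) v| = |f v| := abs_neg (f v)
    have h' : (-f).support ⊆ f.support := (Finsupp.support_neg f).subset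
    exact (absSum_eq h').trans (Finset.sum_congr rfl fun v _ => h v)
  eq_zero_of_map_eq_zero' f hf := Finsupp.ext fun v =>
    abs_eq_zero.1 (le_antisymm ((abs_le_absSum f v).trans_eq hf) (abs_nonneg _))

instance : NormedAddCommGroup (FinL1 V) := (l1Norm V).toNormedAddCommGroup

instance : Module ℝ (FinL1 V) := (Finsupp.module V ℝ : Module ℝ (V →₀ ℝ))

theorem norm_def (f : FinL1 V) : ‖f‖ = absSum f.val := rfl

theorem absSum_smul (c : ℝ) (f : V →₀ ℝ) : absSum (c • f) = |c| * absSum f := by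
  rw [absSum_eq (Finsupp.support_smul (b := c) (g := f)), absSum, Finsupp.sum, Finset.mul_sum]
  exact Finset.sum_congr rfl fun v _ => abs_mul c (f v)

instance : NormedSpace ℝ (FinL1 V) where
  norm_smul_le c f := (absSum_smul c f.val).le

/-- The total mass. -/
def mass (f : V →₀ ℝ) : ℝ := f.sum fun _ a => a

theorem mass_add (f g : V →₀ ℝ) : mass (f + g) = mass f + mass g :=
  Finsupp.sum_add_index' (fun _ => rfl) fun _ _ _ => rfl

theorem mass_smul (c : ℝ) (f : V →₀ ℝ) : mass (c • f) = c * mass f := by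
  rw [mass, Finsupp.sum_smul_index' fun _ => rfl, mass, Finsupp.mul_sum]
  rfl

theorem mass_eq {f : V →₀ ℝ} {s : Finset V} (h : f.support ⊆ s) :
    mass f = ∑ v ∈ s, f v :=
  Finsupp.sum_of_support_subset _ h _ fun _ _ => rfl

theorem mass_pos {f : V →₀ ℝ} (h : ∀ v, 0 ≤ f v) {v : V} (hv : 0 < f v) : 0 < mass f :=
  hv.trans_le (Finset.single_le_sum (f := fun v => f v) (fun v _ => h v)
    (Finsupp.mem_support_iff.2 hv.ne'))

theorem continuous_mass : Continuous fun f : FinL1 V => mass f.val := by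
  let L : FinL1 V →ₗ[ℝ] ℝ := ⟨⟨fun f => mass (val f), fun f g => mass_add f.val g.val⟩,
    fun c f => mass_smul c f.val⟩
  exact (L.mkContinuous 1 fun f => by
    rw [one_mul]
    exact Finset.abs_sum_le_sum_abs _ _).continuous

theorem continuous_apply (v : V) : Continuous fun f : FinL1 V => f.val v := by
  let L : FinL1 V →ₗ[ℝ] ℝ := ⟨⟨fun f => f.val v, fun _ _ => rfl⟩, fun _ _ => rfl⟩
  exact (L.mkContinuous 1 fun f => by
    rw [one_mul]
    exact abs_le_absSum f.val v).continuous

/-- The pointwise minimum. -/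
def min (f g : FinL1 V) : FinL1 V := (f.val ⊓ g.val : V →₀ ℝ)

theorem continuous_min : Continuous fun x : FinL1 V × FinL1 V => min x.1 x.2 := by
  refine (LipschitzWith.of_dist_le_mul (K := 2) fun x y => ?_).continuous
  have h : dist (min x.1 x.2) (min y.1 y.2) ≤ dist x.1 y.1 + dist x.2 y.2 := by
    rw [dist_eq_norm, dist_eq_norm, dist_eq_norm, norm_def, norm_def, norm_def]
    refine absSum_le_add fun v => ?_
    change |Min.min (x.1.val v) (x.2.val v) -
      Min.min (y.1.val v) (y.2.val v)| ≤
      |x.1.val v - y.1.val v| + |x.2.val v - y.2.val v|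
    refine (abs_min_sub_min_le_max _ _ _ _).trans (max_le ?_ ?_)
    · exact le_add_of_nonneg_right (abs_nonneg _)
    · exact le_add_of_nonneg_left (abs_nonneg _)
  refine h.trans ?_
  have h₁ : dist x.1 y.1 ≤ dist x y := le_max_left _ _
  have h₂ : dist x.2 y.2 ≤ dist x y := le_max_right _ _
  push_cast
  linarith

end FinL1

/-! ### The metric realization of a simplicial complex -/

section Metric

variable {V : Type u} {K : AbstractSimplicialComplex V}

/-- The realization with the `ℓ¹`-metric on barycentric coordinates. -/
def MetricRealization (K : AbstractSimplicialComplex V) : Type u := Realization K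

namespace MetricRealization

/-- The barycentric coordinates as an element of `ℓ¹`. -/
def coord (t : MetricRealization K) : FinL1 V := t.1

theorem coord_injective : Function.Injective (coord (K := K)) := Subtype.val_injective

instance : MetricSpace (MetricRealization K) := MetricSpace.induced coord coord_injective
  inferInstance

theorem continuous_iff {A : Type*} [TopologicalSpace A] {f : A → MetricRealization K} :
    Continuous f ↔ Continuous fun a => (f a).coord :=
  continuous_induced_rng

theorem continuous_coord : Continuous (coord (K := K)) := continuous_induced_dom

theorem nonneg (t : MetricRealization K) (v : V) : 0 ≤ t.coord.val v := t.2.2.1 v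

theorem mass_coord (t : MetricRealization K) : FinL1.mass t.coord.val = 1 := t.2.2.2

theorem absSum_coord (t : MetricRealization K) : FinL1.absSum t.coord.val = 1 :=
  (Finset.sum_congr rfl fun v _ => abs_of_nonneg (t.nonneg v)).trans t.mass_coord

theorem dist_eq (s t : MetricRealization K) : dist s t = FinL1.absSum (s.coord.val - t.coord.val) :=
  dist_eq_norm s.coord t.coord

/-- If the pointwise minimum vanishes, the supports are disjoint and the `ℓ¹`-distance of two
probability vectors is at least `2`. So points at distance less than `2` share a vertex, and their
minimum can be normalized. -/
theorem mass_min_pos {s t : MetricRealization K} (h : dist s t < 2) :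
    0 < FinL1.mass (s.coord.val ⊓ t.coord.val) := by
  by_contra! hm
  have h0 (v : V) : Min.min (s.coord.val v) (t.coord.val v) = 0 := by
    by_contra hv
    have hnn (v : V) : 0 ≤ (s.coord.val ⊓ t.coord.val) v := le_min (s.nonneg v) (t.nonneg v)
    exact absurd (FinL1.mass_pos hnn (lt_of_le_of_ne (hnn v) (Ne.symm hv))) hm.not_gt
  have h1 : 2 ≤ dist s t := by
    classical
    rw [dist_eq, FinL1.absSum_eq (s := s.coord.val.support ∪ t.coord.val.support) Finsupp.support_sub,
      ← one_add_one_eq_two]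
    have hs := s.mass_coord
    have ht := t.mass_coord
    rw [FinL1.mass_eq (Finset.subset_union_left (s₂ := t.coord.val.support))] at hs
    rw [FinL1.mass_eq (Finset.subset_union_right (s₁ := s.coord.val.support))] at ht
    refine (congrArg₂ (· + ·) hs ht).symm.le.trans ?_
    rw [← Finset.sum_add_distrib]
    refine Finset.sum_le_sum fun v _ => ?_
    have hs := s.nonneg v
    have ht := t.nonneg v
    rw [Finsupp.sub_apply]
    rcases min_choice (s.coord.val v) (t.coord.val v) with e | e <;> rw [h0] at e <;> rw [← e] <;>
      simp [abs_of_nonneg, hs, ht]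
  exact absurd h h1.not_gt

/-! ### Paths between nearby points, continuous in both ends -/

/-- The element of `ℓ¹` at time `τ` on the path from `s` to `t` through their normalized
minimum. -/
def pathL1 (s t : FinL1 V) (τ : ℝ) : FinL1 V :=
  (1 - min (2 * τ) 1) • s +
    (min (2 * τ) 1 - max (2 * τ - 1) 0) • ((FinL1.mass (FinL1.min s t).val)⁻¹ • FinL1.min s t) +
    max (2 * τ - 1) 0 • t

theorem pathL1_zero (s t : FinL1 V) : pathL1 s t 0 = s := by
  simp [pathL1]

theorem pathL1_one (s t : FinL1 V) : pathL1 s t 1 = t := by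
  norm_num [pathL1]

theorem pathL1_self (s : MetricRealization K) (τ : ℝ) : pathL1 s.coord s.coord τ = s.coord := by
  have h : FinL1.min s.coord s.coord = s.coord := inf_idem (a := s.coord.val)
  have h' : FinL1.mass s.coord.val = 1 := s.mass_coord
  rw [pathL1, h, h', inv_one, one_smul, ← add_smul, ← add_smul]
  convert one_smul ℝ s.coord using 2
  ring

/-- The minimum is supported in both supports. At every time the weight of `s` or that of `t` is
zero, so the path runs first in the simplex of `s` and then in that of `t`. -/
theorem pathL1_mem {s t : MetricRealization K} (h : dist s t < 2) {τ : ℝ} (h0 : 0 ≤ τ)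
    (h1 : τ ≤ 1) :
    (pathL1 s.coord t.coord τ).val.support ∈ K.faces ∧
      (∀ v, 0 ≤ (pathL1 s.coord t.coord τ).val v) ∧
      FinL1.mass (pathL1 s.coord t.coord τ).val = 1 := by
  have hm := mass_min_pos h
  have ha : min (2 * τ) 1 ≤ 1 := min_le_right _ _
  have hb : 0 ≤ max (2 * τ - 1) 0 := le_max_right _ _
  have hab : max (2 * τ - 1) 0 ≤ min (2 * τ) 1 := by
    refine max_le (le_min ?_ ?_) (le_min ?_ ?_) <;> linarith
  have hcase : min (2 * τ) 1 = 1 ∨ max (2 * τ - 1) 0 = 0 := by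
    rcases le_total 1 (2 * τ) with h | h
    · exact Or.inl (min_eq_right h)
    · exact Or.inr (max_eq_right (by linarith))
  set a := min (2 * τ) 1
  set b := max (2 * τ - 1) 0
  have hval (v : V) : (pathL1 s.coord t.coord τ).val v =
      (1 - a) * s.coord.val v + (a - b) * ((FinL1.mass (s.coord.val ⊓ t.coord.val))⁻¹ * min (s.coord.val v) (t.coord.val v)) +
        b * t.coord.val v := rfl
  have hmass : FinL1.mass (pathL1 s.coord t.coord τ).val = 1 := by
    have : FinL1.mass (pathL1 s.coord t.coord τ).val = (1 - a) * FinL1.mass s.coord.val +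
        (a - b) * ((FinL1.mass (s.coord.val ⊓ t.coord.val))⁻¹ * FinL1.mass (s.coord.val ⊓ t.coord.val)) +
          b * FinL1.mass t.coord.val := by
      rw [← FinL1.mass_smul, ← FinL1.mass_smul, ← FinL1.mass_smul, ← FinL1.mass_smul,
        ← FinL1.mass_add, ← FinL1.mass_add]
      rfl
    rw [this, s.mass_coord, t.mass_coord, inv_mul_cancel₀ hm.ne']
    ring
  refine ⟨?_, fun v => ?_, hmass⟩
  · have hne : ((pathL1 s.coord t.coord τ).val.support).Nonempty := by
      rw [Finset.nonempty_iff_ne_empty]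
      intro h
      rw [FinL1.mass_eq h.subset] at hmass
      simp at hmass
    have hsub : (pathL1 s.coord t.coord τ).val.support ⊆ s.coord.val.support ∨
        (pathL1 s.coord t.coord τ).val.support ⊆ t.coord.val.support := by
      rcases hcase with hc | hc
      · refine Or.inr fun v hv => ?_
        rw [Finsupp.mem_support_iff, hval] at hv
        rw [Finsupp.mem_support_iff]
        intro h
        rw [h, min_eq_right (s.nonneg v), hc] at hv
        simp at hv
      · refine Or.inl fun v hv => ?_
        rw [Finsupp.mem_support_iff, hval] at hv
        rw [Finsupp.mem_support_iff]
        intro h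
        rw [h, min_eq_left (t.nonneg v), hc] at hv
        simp at hv
    rcases hsub with hsub | hsub
    · exact (K.isRelLowerSet_faces s.2.1).2 hsub hne
    · exact (K.isRelLowerSet_faces t.2.1).2 hsub hne
  · rw [hval]
    have := s.nonneg v
    have := t.nonneg v
    have := le_min (s.nonneg v) (t.nonneg v)
    have : 0 ≤ 1 - a := by linarith
    have : 0 ≤ a - b := by linarith
    positivity

/-- A cutoff function of the distance. -/
def cutoff (d : ℝ) : ℝ := max 0 (min 1 (3 - 2 * d))

/-- Move `s` towards `t`, if `s` and `t` are close. -/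
def push (s t : MetricRealization K) (τ : I) : MetricRealization K :=
  open Classical in
  if h : dist s t < 2 then
    ⟨(pathL1 s.coord t.coord (τ * cutoff (dist s t))).val, pathL1_mem h
      (mul_nonneg τ.2.1 (le_max_left _ _)) (mul_le_one₀ τ.2.2 (le_max_left _ _)
        (max_le zero_le_one (min_le_left _ _)))⟩
  else s

theorem push_of_not_lt {s t : MetricRealization K} (h : ¬dist s t < 2) (τ : I) :
    push s t τ = s := dif_neg h

theorem coord_push {s t : MetricRealization K} (h : dist s t < 2) (τ : I) :
    (push s t τ).coord = pathL1 s.coord t.coord (τ * cutoff (dist s t)) := by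
  exact congrArg coord (dif_pos h)

theorem push_zero (s t : MetricRealization K) : push s t 0 = s := by
  by_cases h : dist s t < 2
  · apply coord_injective
    rw [coord_push h, Set.Icc.coe_zero, zero_mul, pathL1_zero]
  · exact push_of_not_lt h _

theorem push_self (s : MetricRealization K) (τ : I) : push s s τ = s := by
  apply coord_injective
  rw [coord_push (by rw [dist_self]; exact two_pos), pathL1_self]

theorem push_one {s t : MetricRealization K} (h : dist s t ≤ 1) : push s t 1 = t := by
  apply coord_injective
  have hc : cutoff (dist s t) = 1 := by
    rw [cutoff, min_eq_left (by linarith), max_eq_right zero_le_one]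
  rw [coord_push (by linarith), hc, Set.Icc.coe_one, one_mul, pathL1_one]

theorem push_of_le {s t : MetricRealization K} (h : 3 / 2 ≤ dist s t) (τ : I) :
    push s t τ = s := by
  by_cases h' : dist s t < 2
  · apply coord_injective
    have hc : cutoff (dist s t) = 0 := by
      rw [cutoff, max_eq_left]
      exact (min_le_right _ _).trans (by linarith)
    rw [coord_push h', hc, mul_zero, pathL1_zero]
  · exact push_of_not_lt h' _

/-- Where the distance is below `2`, the explicit formula applies and the mass that it inverts is
nonzero. Where it exceeds `3 / 2`, the cutoff vanishes and the point `s` does not move. These two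
open sets cover. -/
theorem continuous_push :
    Continuous fun x : (MetricRealization K × MetricRealization K) × I => push x.1.1 x.1.2 x.2 := by
  have hd : Continuous fun x : (MetricRealization K × MetricRealization K) × I =>
      dist x.1.1 x.1.2 := by fun_prop
  rw [continuous_iff, continuous_iff_continuousAt]
  intro x
  rcases lt_or_ge (dist x.1.1 x.1.2) 2 with h | h
  · have hev : (fun x : (MetricRealization K × MetricRealization K) × I =>
        (push x.1.1 x.1.2 x.2).coord) =ᶠ[nhds x] fun x =>
        pathL1 x.1.1.coord x.1.2.coord (x.2 * cutoff (dist x.1.1 x.1.2)) := by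
      filter_upwards [hd.continuousAt.eventually (gt_mem_nhds h)] with y hy
      exact coord_push hy _
    refine ContinuousAt.congr ?_ hev.symm
    have h1 : Continuous fun x : (MetricRealization K × MetricRealization K) × I => x.1.1.coord :=
      continuous_coord.comp (continuous_fst.comp continuous_fst)
    have h2 : Continuous fun x : (MetricRealization K × MetricRealization K) × I => x.1.2.coord :=
      continuous_coord.comp (continuous_snd.comp continuous_fst)
    have h3 : Continuous fun x : (MetricRealization K × MetricRealization K) × I =>
        (x.2 : ℝ) * cutoff (dist x.1.1 x.1.2) := by
      unfold cutoff
      fun_prop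
    have h4 : Continuous fun x : (MetricRealization K × MetricRealization K) × I =>
        FinL1.min x.1.1.coord x.1.2.coord := FinL1.continuous_min.comp (h1.prodMk h2)
    have h5 := (FinL1.continuous_mass.comp h4).continuousAt (x := x)
    have h6 := h5.inv₀ (mass_min_pos h).ne'
    unfold pathL1
    refine ContinuousAt.add (ContinuousAt.add ?_ ?_) ?_
    · exact ((by fun_prop : Continuous fun x : (MetricRealization K × MetricRealization K) × I =>
        (1 - min (2 * ((x.2 : ℝ) * cutoff (dist x.1.1 x.1.2))) 1)).smul h1).continuousAt
    · exact (by fun_prop : Continuous fun x : (MetricRealization K × MetricRealization K) × I =>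
        (min (2 * ((x.2 : ℝ) * cutoff (dist x.1.1 x.1.2))) 1 -
          max (2 * ((x.2 : ℝ) * cutoff (dist x.1.1 x.1.2)) - 1) 0)).continuousAt.smul
          (h6.smul h4.continuousAt)
    · exact ((by fun_prop : Continuous fun x : (MetricRealization K × MetricRealization K) × I =>
        max (2 * ((x.2 : ℝ) * cutoff (dist x.1.1 x.1.2)) - 1) 0).smul h2).continuousAt
  · have hev : (fun x : (MetricRealization K × MetricRealization K) × I =>
        (push x.1.1 x.1.2 x.2).coord) =ᶠ[nhds x] fun x => x.1.1.coord := by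
      filter_upwards [hd.continuousAt.eventually (lt_mem_nhds (lt_of_lt_of_le
        (by norm_num : (3 / 2 : ℝ) < 2) h))] with y hy
      rw [push_of_le hy.le]
    exact ContinuousAt.congr
      (continuous_coord.comp (continuous_fst.comp continuous_fst)).continuousAt hev.symm

/-! ### Straightening a homotopy at a point by deforming the target -/

/-- A homotopy that moves the point `z` only a little can be straightened at `z` after a
self-map of the target that is homotopic to the identity. -/
theorem exists_slide_of_dist_le {Z : Type*} [TopologicalSpace Z] {z : Z}
    {f g : C(Z, MetricRealization K)} (H : f.Homotopy g)
    (hz : ∀ t, dist (H (t, z)) (g z) ≤ 1) :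
    ∃ D : C(MetricRealization K, MetricRealization K),
      D.Homotopic (ContinuousMap.id _) ∧ (D.comp f).HomotopicRel g {z} := by
  let D : C(MetricRealization K, MetricRealization K) :=
    ⟨fun s => push s (g z) 1, continuous_push.comp (f := fun s => ((s, g z), 1)) (by fun_prop)⟩
  -- `D` collapses the whole track of `z` to `g z`, so `D ∘ H` is a homotopy relative to `z`.
  have hD (t : I) : D (H (t, z)) = g z := push_one (hz t)
  refine ⟨D, ContinuousMap.Homotopic.symm ⟨⟨⟨fun x => push x.2 (g z) x.1,
    continuous_push.comp (f := fun x : I × MetricRealization K => ((x.2, g z), x.1))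
      (by fun_prop)⟩, fun s => push_zero _ _, fun s => rfl⟩⟩, ?_⟩
  -- First `D ∘ H` from `D ∘ f` to `D ∘ g`; then back from `D ∘ g` to `g` along `push`, which is
  -- stationary at `z` because a point pushed towards itself stays.
  refine ContinuousMap.HomotopicRel.trans (g := D.comp g) ⟨⟨⟨⟨fun x => D (H x), ?_⟩, ?_, ?_⟩, ?_⟩⟩
    (ContinuousMap.HomotopicRel.symm ⟨⟨⟨⟨fun x => push (g x.2) (g z) x.1, ?_⟩, ?_, ?_⟩, ?_⟩⟩)
  · fun_prop
  · intro x
    change D (H (0, x)) = _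
    rw [H.apply_zero]
    rfl
  · intro x
    change D (H (1, x)) = _
    rw [H.apply_one]
    rfl
  · rintro t _ rfl
    have := hD 0
    rw [H.apply_zero] at this
    exact (hD t).trans this.symm
  · exact continuous_push.comp (f := fun x : I × Z => ((g x.2, g z), x.1)) (by fun_prop)
  · exact fun x => push_zero _ _
  · exact fun x => rfl
  · rintro t _ rfl
    exact push_self _ _

end MetricRealization

end Metric

section Metric

variable {V : Type u} {K : AbstractSimplicialComplex V}

namespace MetricRealization

/-- A homotopy into a metric realization can be straightened at any given point after a self-map of
the target that is homotopic to the identity. -/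
theorem exists_slide {Z : Type*} [TopologicalSpace Z] (z : Z)
    {f g : C(Z, MetricRealization K)} (H : f.Homotopy g) :
    ∃ D : C(MetricRealization K, MetricRealization K),
      D.Homotopic (ContinuousMap.id _) ∧ (D.comp f).HomotopicRel g {z} := by
  let h (t : I) : C(Z, MetricRealization K) := ⟨fun x => H (t, x), by fun_prop⟩
  have h0 : h 0 = f := ContinuousMap.ext H.apply_zero
  have h1 : h 1 = g := ContinuousMap.ext H.apply_one
  have hI (s t τ : I) : (1 - (τ : ℝ)) * (s : ℝ) + (τ : ℝ) * (t : ℝ) ∈ I :=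
    convex_Icc 0 1 s.2 t.2 (sub_nonneg.2 τ.2.2) τ.2.1 (by ring)
  -- The short case, applied to the portion of `H` between the times `s` and `t`, in either
  -- direction.
  have key (s t : I) (hst : ∀ τ : I, dist (H (⟨_, hI s t τ⟩, z)) (H (t, z)) ≤ 1) :
      ∃ D : C(MetricRealization K, MetricRealization K),
        D.Homotopic (ContinuousMap.id _) ∧ (D.comp (h s)).HomotopicRel (h t) {z} := by
    refine exists_slide_of_dist_le ⟨⟨fun x => H (⟨_, hI s t x.1⟩, x.2), by fun_prop⟩, ?_, ?_⟩ hst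
    · intro x
      change H (_, x) = H (s, x)
      congr 2
      ext
      simp
    · intro x
      change H (_, x) = H (t, x)
      congr 2
      ext
      simp
  rw [← h0, ← h1]
  -- The relation between times is transitive and holds both ways for nearby times, so by
  -- connectedness of the interval it holds between `0` and `1`.
  refine PreconnectedSpace.induction₂' (fun s t : I => ∃ D : C(MetricRealization K,
    MetricRealization K), D.Homotopic (ContinuousMap.id _) ∧
      (D.comp (h s)).HomotopicRel (h t) {z}) ?_ ?_ 0 1
  · intro x
    have hc : Continuous fun t : I => H (t, z) := by fun_prop
    -- Within `δ` of `x` the track stays within `1 / 2` of `H (x, z)`, so any two of its points are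
    -- at distance at most `1`, as `push_one` requires.
    obtain ⟨δ, hδ, hx⟩ := Metric.continuousAt_iff.1 (hc.continuousAt (x := x)) (1 / 2) (by norm_num)
    have hseg (a b τ : I) (ha : dist a x < δ) (hb : dist b x < δ) :
        dist (⟨_, hI a b τ⟩ : I) x < δ :=
      convex_ball (x : ℝ) δ ha hb (sub_nonneg.2 τ.2.2) τ.2.1 (by ring)
    have hkey (a b : I) (ha : dist a x < δ) (hb : dist b x < δ) (τ : I) :
        dist (H (⟨_, hI a b τ⟩, z)) (H (b, z)) ≤ 1 := by
      have h1 := hx (hseg a b τ ha hb)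
      have h2 := hx hb
      exact (dist_triangle_right _ _ (H (x, z))).trans (by linarith)
    have hxx : dist x x < δ := by rwa [dist_self]
    filter_upwards [Metric.ball_mem_nhds x hδ] with y hy
    exact ⟨key _ _ (hkey _ _ hxx hy), key _ _ (hkey _ _ hy hxx)⟩
  · constructor
    rintro s t r ⟨D, hD, hst⟩ ⟨E, hE, htr⟩
    -- `E` carries the first relative homotopy to one ending at `E ∘ h t`, where the second begins.
    refine ⟨E.comp D, hE.comp hD, ?_⟩
    obtain ⟨G⟩ := hst
    exact ContinuousMap.HomotopicRel.trans ⟨G.compContinuousMap E⟩ htr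

end MetricRealization

/-! ### Comparison of the weak and the metric topology -/

theorem Realization.continuous_dom_iff {B : Type*} [TopologicalSpace B] {f : Realization K → B} :
    Continuous f ↔ ∀ s ∈ K.faces, Continuous fun t : ClosedSimplex K s => f t.1 := by
  simp only [continuous_iSup_dom, continuous_coinduced_dom]
  rfl

theorem Realization.continuous_val {s : Finset V} (hs : s ∈ K.faces) :
    Continuous fun t : ClosedSimplex K s => t.1 :=
  Realization.continuous_dom_iff.1 continuous_id s hs

/-- A map to a realization is continuous if its barycentric coordinates are continuous and locally
only finitely many vertices are involved. -/
theorem Realization.continuous_of_locally_finite {A : Type*} [TopologicalSpace A]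
    {g : A → Realization K} (hc : ∀ v, Continuous fun a => (g a).1 v)
    (hf : ∀ a, ∃ F : Finset V, ∀ᶠ x in nhds a, (g x).1.support ⊆ F) : Continuous g := by
  refine continuous_iff_continuousAt.2 fun a => ?_
  obtain ⟨F, hF⟩ := hf a
  obtain ⟨N, hN, hNo, haN⟩ := eventually_nhds_iff.1 hF
  refine ContinuousOn.continuousAt ?_ (hNo.mem_nhds haN)
  rw [continuousOn_iff_continuous_domRestrict]
  have hcN (v : V) : Continuous fun x : N => (g x).1 v := (hc v).comp continuous_subtype_val
  -- Near `a` only the finitely many faces inside `F` occur. They give a finite closed cover, and on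
  -- each piece the map lands in one closed simplex, where coordinates decide continuity.
  refine LocallyFinite.continuous (ι := {s : Finset V // s ∈ F.powerset ∧ s ∈ K.faces})
    (f := fun s => {x : N | (g x).1.support ⊆ s.1}) ?_ ?_ ?_ ?_
  · have : Finite {s : Finset V // s ∈ F.powerset ∧ s ∈ K.faces} :=
      (F.powerset.finite_toSet.subset fun s hs => hs.1).to_subtype
    exact locallyFinite_of_finite _
  · exact eq_univ_of_forall fun x => mem_iUnion.2
      ⟨⟨(g x).1.support, Finset.mem_powerset.2 (hN x x.2), (g x).2.1⟩, Finset.Subset.refl _⟩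
  · intro s
    have : {x : N | (g x).1.support ⊆ s.1} = ⋂ v ∈ (s.1 : Set V)ᶜ, {x : N | (g x).1 v = 0} := by
      ext x
      simp only [mem_ofPred_eq, mem_iInter, mem_compl_iff]
      exact ⟨fun h v hv => Finsupp.notMem_support_iff.1 fun h' => hv (h h'), fun h v hv =>
        by_contra fun h' => Finsupp.mem_support_iff.1 hv (h v h')⟩
    rw [this]
    exact isClosed_biInter fun v _ => isClosed_eq (hcN v) continuous_const
  · intro s
    rw [continuousOn_iff_continuous_domRestrict]
    let g' : {x : N | (g x).1.support ⊆ s.1} → ClosedSimplex K s.1 := fun x => ⟨g x.1, x.2⟩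
    have hg' : Continuous g' := continuous_induced_rng.2
      (continuous_pi fun v => (hcN v).comp continuous_subtype_val)
    exact (Realization.continuous_val s.2.2).comp hg'

theorem ClosedSimplex.continuous_coord {s : Finset V} (v : V) :
    Continuous fun t : ClosedSimplex K s => t.1.1 v :=
  (continuous_apply v).comp continuous_induced_dom

/-- The identity map from the weak to the metric topology. -/
def toMetric (K : AbstractSimplicialComplex V) : C(Realization K, MetricRealization K) where
  toFun t := t
  continuous_toFun := by
    refine Realization.continuous_dom_iff.2 fun s _ => MetricRealization.continuous_iff.2 ?_
    have h : (fun t : ClosedSimplex K s => MetricRealization.coord (K := K) t.1) =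
        fun t => ∑ v ∈ s, t.1.1 v • (Finsupp.single v 1 : FinL1 V) := by
      funext t
      have := Finsupp.sum_of_support_subset t.1.1 t.2 (fun v a => a • Finsupp.single v (1 : ℝ))
        (by simp)
      refine Eq.trans ?_ this
      refine (Finsupp.sum_single t.1.1).symm.trans ?_
      simp
    rw [h]
    exact continuous_finsetSum _ fun v _ =>
      (ClosedSimplex.continuous_coord v).smul continuous_const

/-! ### Back from the metric to the weak topology -/

namespace MetricRealization

theorem continuous_weight (v : V) : Continuous fun t : MetricRealization K => t.coord.val v :=
  (FinL1.continuous_apply v).comp continuous_coord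

theorem weight_le_one (t : MetricRealization K) (v : V) : t.coord.val v ≤ 1 :=
  (le_abs_self _).trans ((FinL1.abs_le_absSum _ v).trans_eq t.absSum_coord)

/-- The sum of the squares of the barycentric coordinates. -/
def sq (t : MetricRealization K) : ℝ := FinL1.mass (t.coord.val * t.coord.val)

theorem sq_eq (t : MetricRealization K) {F : Finset V} (h : t.coord.val.support ⊆ F) :
    t.sq = ∑ v ∈ F, t.coord.val v * t.coord.val v :=
  FinL1.mass_eq (f := t.coord.val * t.coord.val)
    ((Finsupp.support_mul_subset_left).trans h)

theorem exists_weight_pos (t : MetricRealization K) : ∃ v, 0 < t.coord.val v := by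
  by_contra! h
  have := t.mass_coord
  rw [FinL1.mass, Finsupp.sum, Finset.sum_eq_zero fun v _ => le_antisymm (h v) (t.nonneg v)] at this
  exact zero_ne_one this

theorem sq_pos (t : MetricRealization K) : 0 < t.sq := by
  obtain ⟨v, hv⟩ := t.exists_weight_pos
  exact FinL1.mass_pos (f := t.coord.val * t.coord.val) (fun v => mul_self_nonneg _)
    (v := v) (mul_pos hv hv)

theorem continuous_sq : Continuous (sq (K := K)) := by
  refine (LipschitzWith.of_dist_le_mul (K := 2) fun s t => ?_).continuous
  classical
  rw [Real.dist_eq, dist_eq, FinL1.absSum_eq (s := s.coord.val.support ∪ t.coord.val.support)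
    Finsupp.support_sub, s.sq_eq Finset.subset_union_left, t.sq_eq Finset.subset_union_right,
    ← Finset.sum_sub_distrib, Finset.mul_sum]
  refine (Finset.abs_sum_le_sum_abs _ _).trans (Finset.sum_le_sum fun v _ => ?_)
  rw [mul_self_sub_mul_self, abs_mul]
  refine mul_le_mul_of_nonneg_right ?_ (abs_nonneg _)
  rw [abs_of_nonneg (add_nonneg (s.nonneg v) (t.nonneg v))]
  have := s.weight_le_one v
  have := t.weight_le_one v
  push_cast
  linarith

/-- The barycentric coordinates, cut off at half of `sq`. -/
def trim (t : MetricRealization K) : V →₀ ℝ :=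
  t.coord.val.mapRange (fun a => max 0 (a - t.sq / 2))
    (max_eq_left (by linarith [t.sq_pos]))

theorem trim_apply (t : MetricRealization K) (v : V) :
    t.trim v = max 0 (t.coord.val v - t.sq / 2) := rfl

theorem trim_nonneg (t : MetricRealization K) (v : V) : 0 ≤ t.trim v := le_max_left _ _

theorem support_trim_subset (t : MetricRealization K) : t.trim.support ⊆ t.coord.val.support :=
  Finsupp.support_mapRange

theorem continuous_trim (v : V) : Continuous fun t : MetricRealization K => t.trim v :=
  continuous_const.max ((continuous_weight v).sub (continuous_sq.div_const _))

/-- Some coordinate exceeds `sq / 2`: otherwise `∑ t_v² ≤ (sq / 2) ∑ t_v = sq / 2`, which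
contradicts `sq > 0`. -/
theorem mass_trim_pos (t : MetricRealization K) : 0 < FinL1.mass t.trim := by
  by_contra! h
  have h0 (v : V) : t.coord.val v ≤ t.sq / 2 := by
    by_contra! hv
    exact absurd (FinL1.mass_pos t.trim_nonneg (v := v)
      (lt_max_of_lt_right (sub_pos.2 hv))) h.not_gt
  have : t.sq ≤ t.sq / 2 * 1 := by
    conv_lhs => rw [t.sq_eq subset_rfl]
    rw [← t.mass_coord, FinL1.mass_eq subset_rfl, Finset.mul_sum]
    exact Finset.sum_le_sum fun v _ => mul_le_mul_of_nonneg_right (h0 v) (t.nonneg v)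
  linarith [t.sq_pos]

/-- A vertex that survives trimming at `x` has weight above `x.sq / 2 > t.sq / 4`. If `x` is within
`t.sq / 8` of `t`, its weight at `t` is still positive. This local finiteness makes the trimmed map
continuous into the weak topology. -/
theorem eventually_support_trim (t : MetricRealization K) :
    ∀ᶠ x in nhds t, x.trim.support ⊆ t.coord.val.support := by
  have hq := t.sq_pos
  filter_upwards [continuous_sq.continuousAt.eventually (lt_mem_nhds (half_lt_self hq)),
    Metric.ball_mem_nhds t (by linarith : 0 < t.sq / 8)] with x hx hxt v hv
  have h1 : 0 < x.trim v := lt_of_le_of_ne (x.trim_nonneg v) (Finsupp.mem_support_iff.1 hv).symm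
  have h2 : x.sq / 2 < x.coord.val v := by
    rw [trim_apply, lt_max_iff] at h1
    exact sub_pos.1 (h1.resolve_left (lt_irrefl _))
  have h3 : |x.coord.val v - t.coord.val v| ≤ dist x t :=
    (FinL1.abs_le_absSum (x.coord.val - t.coord.val) v).trans_eq (dist_eq x t).symm
  have h4 := (abs_le.1 h3).2
  have h5 : dist x t < t.sq / 8 := hxt
  refine Finsupp.mem_support_iff.2 (ne_of_gt ?_)
  linarith

theorem continuous_mass_trim : Continuous fun t : MetricRealization K => FinL1.mass t.trim := by
  refine continuous_iff_continuousAt.2 fun t => ?_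
  have hev : (fun x : MetricRealization K => FinL1.mass x.trim) =ᶠ[nhds t]
      fun x => ∑ v ∈ t.coord.val.support, x.trim v := by
    filter_upwards [t.eventually_support_trim] with x hx
    exact FinL1.mass_eq hx
  exact ContinuousAt.congr (continuous_finsetSum _ fun v _ => continuous_trim v).continuousAt
    hev.symm

theorem trim_normalized_mem (t : MetricRealization K) :
    ((FinL1.mass t.trim)⁻¹ • t.trim).support ∈ K.faces ∧
      (∀ v, 0 ≤ ((FinL1.mass t.trim)⁻¹ • t.trim) v) ∧
      FinL1.mass ((FinL1.mass t.trim)⁻¹ • t.trim) = 1 := by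
  have hm : FinL1.mass ((FinL1.mass t.trim)⁻¹ • t.trim) = 1 := by
    rw [FinL1.mass_smul, inv_mul_cancel₀ t.mass_trim_pos.ne']
  refine ⟨(K.isRelLowerSet_faces t.2.1).2 (Finsupp.support_smul.trans t.support_trim_subset) ?_,
    fun v => mul_nonneg (inv_nonneg.2 t.mass_trim_pos.le) (t.trim_nonneg v), hm⟩
  rw [Finset.nonempty_iff_ne_empty]
  intro h
  rw [FinL1.mass_eq h.subset] at hm
  simp at hm

/-- A continuous map from the metric to the weak topology, homotopy inverse to the identity. -/
def toWeak (K : AbstractSimplicialComplex V) : C(MetricRealization K, Realization K) where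
  toFun t := ⟨(FinL1.mass t.trim)⁻¹ • t.trim, t.trim_normalized_mem⟩
  continuous_toFun := by
    refine Realization.continuous_of_locally_finite (fun v => ?_) fun t => ?_
    · exact (continuous_mass_trim.inv₀ fun t => t.mass_trim_pos.ne').mul (continuous_trim v)
    · refine ⟨t.coord.val.support, ?_⟩
      filter_upwards [t.eventually_support_trim] with x hx
      exact Finsupp.support_smul.trans hx

theorem support_toWeak_subset (t : MetricRealization K) :
    (toWeak K t).1.support ⊆ t.coord.val.support :=
  Finsupp.support_smul.trans t.support_trim_subset

end MetricRealization

/-! ### Straight-line homotopies in the weak topology -/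

/-- The point dividing the segment between two points of a simplex in a given ratio. -/
def Realization.segment (s t : Realization K) (h : s.1.support ⊆ t.1.support) (τ : I) :
    Realization K :=
  ⟨(1 - (τ : ℝ)) • s.1 + (τ : ℝ) • t.1, by
    have hm : FinL1.mass ((1 - (τ : ℝ)) • s.1 + (τ : ℝ) • t.1) = 1 := by
      have hs : FinL1.mass s.1 = 1 := s.2.2.2
      have ht : FinL1.mass t.1 = 1 := t.2.2.2
      rw [FinL1.mass_add, FinL1.mass_smul, FinL1.mass_smul, hs, ht]
      ring
    refine ⟨(K.isRelLowerSet_faces t.2.1).2 ?_ ?_, fun v => ?_, hm⟩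
    · intro v hv
      by_contra hv'
      have ht := Finsupp.notMem_support_iff.1 hv'
      have hs := Finsupp.notMem_support_iff.1 fun h' => hv' (h h')
      rw [Finsupp.mem_support_iff, Finsupp.add_apply, Finsupp.smul_apply, Finsupp.smul_apply,
        ht, hs] at hv
      simp at hv
    · rw [Finset.nonempty_iff_ne_empty]
      intro h
      rw [FinL1.mass_eq h.subset] at hm
      simp at hm
    · exact add_nonneg (mul_nonneg (sub_nonneg.2 τ.2.2) (s.2.2.1 v))
        (mul_nonneg τ.2.1 (t.2.2.1 v))⟩

theorem Realization.support_segment_subset (s t : Realization K) (h : s.1.support ⊆ t.1.support)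
    (τ : I) : (Realization.segment s t h τ).1.support ⊆ t.1.support := by
  intro v hv
  by_contra hv'
  have ht := Finsupp.notMem_support_iff.1 hv'
  have hs := Finsupp.notMem_support_iff.1 fun h' => hv' (h h')
  refine Finsupp.mem_support_iff.1 hv ?_
  change (1 - (τ : ℝ)) * s.1 v + τ * t.1 v = 0
  rw [ht, hs]
  simp

theorem Realization.segment_zero (s t : Realization K) (h : s.1.support ⊆ t.1.support) :
    Realization.segment s t h 0 = s := by
  refine Subtype.ext (Finsupp.ext fun v => ?_)
  change (1 - (0 : ℝ)) * s.1 v + 0 * t.1 v = _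
  rw [sub_zero, one_mul, zero_mul, add_zero]

theorem Realization.segment_one (s t : Realization K) (h : s.1.support ⊆ t.1.support) :
    Realization.segment s t h 1 = t := by
  refine Subtype.ext (Finsupp.ext fun v => ?_)
  change (1 - (1 : ℝ)) * s.1 v + 1 * t.1 v = _
  rw [sub_self, one_mul, zero_mul, zero_add]

/-- A map defined on the product of a realization and the unit interval is continuous if it is
continuous on the product of every closed simplex and the interval. -/
theorem Realization.continuous_prod_interval {B : Type*} [TopologicalSpace B]
    {f : Realization K × I → B}
    (hf : ∀ s ∈ K.faces, Continuous fun x : ClosedSimplex K s × I => f (x.1.1, x.2)) :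
    Continuous f := by
  have hft (t : Realization K) : Continuous fun τ : I => f (t, τ) := by
    let t' : ClosedSimplex K t.1.support := ⟨t, subset_rfl⟩
    exact (hf _ t.2.1).comp (Continuous.prodMk_right t')
  -- Currying turns the claim into continuity of a map out of the realization itself, which the
  -- closed simplices detect; uncurrying is allowed because `I` is locally compact.
  let F : Realization K → C(I, B) := fun t => ⟨fun τ => f (t, τ), hft t⟩
  have hF : Continuous F := Realization.continuous_dom_iff.2 fun s hs =>
    (ContinuousMap.curry ⟨fun x : ClosedSimplex K s × I => f (x.1.1, x.2), hf s hs⟩).continuous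
  exact ContinuousMap.continuous_uncurry_of_continuous ⟨F, hF⟩

/-- Trimming does not enlarge supports, so the segment from the trimmed point to `t` stays in the
simplex of `t`. This composite is all that is needed: maps into the polyhedron pass to the metric
topology, are modified there, and return. -/
theorem toWeak_comp_toMetric_homotopic (K : AbstractSimplicialComplex V) :
    ((MetricRealization.toWeak K).comp (toMetric K)).Homotopic (ContinuousMap.id _) := by
  have hsub (t : Realization K) :
      (MetricRealization.toWeak K (toMetric K t)).1.support ⊆ t.1.support :=
    MetricRealization.support_toWeak_subset (toMetric K t)
  have hcoord {s : Finset V} (hs : s ∈ K.faces) (v : V) :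
      Continuous fun x : ClosedSimplex K s × I =>
        (Realization.segment _ x.1.1 (hsub x.1.1) x.2).1 v := by
    have h1 : Continuous fun x : ClosedSimplex K s × I =>
        (MetricRealization.toWeak K (toMetric K x.1.1)).1 v :=
      ((MetricRealization.continuous_mass_trim.inv₀ fun t => t.mass_trim_pos.ne').mul
        (MetricRealization.continuous_trim v)).comp
        ((toMetric K).continuous.comp ((Realization.continuous_val hs).comp continuous_fst))
    have h2 : Continuous fun x : ClosedSimplex K s × I => x.1.1.1 v :=
      (ClosedSimplex.continuous_coord v).comp continuous_fst
    exact ((continuous_const.sub (continuous_subtype_val.comp continuous_snd)).mul h1).add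
      ((continuous_subtype_val.comp continuous_snd).mul h2)
  have hf : Continuous fun x : Realization K × I =>
      Realization.segment _ x.1 (hsub x.1) x.2 :=
    Realization.continuous_prod_interval fun s hs =>
      Realization.continuous_of_locally_finite (hcoord hs) fun _ => ⟨s,
        Filter.Eventually.of_forall fun x =>
          (Realization.support_segment_subset _ _ _ _).trans x.1.2⟩
  exact ⟨⟨⟨_, hf.comp continuous_swap⟩, fun t => Realization.segment_zero _ _ (hsub t),
    fun t => Realization.segment_one _ _ (hsub t)⟩⟩

end Metric

/-! ### Forgetting marked points -/

namespace HTop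

variable {A : Type} {X Y Z : HTop.{u} A}

theorem toHom_eq_iff {f g : Map X Y} :
    toHom f = toHom g ↔ f.1.HomotopicRel g.1 (range X.pt) :=
  Quotient.eq (r := mapSetoid X Y)

/-- The underlying space of a marked space. -/
def free (X : HTop.{u} A) : HTop.{u} Empty := space X.carrier

/-- A continuous map as a map of plain spaces. -/
def Map.plain {X Y : HTop.{u} Empty} (f : C(X.carrier, Y.carrier)) : Map X Y :=
  ⟨f, fun a => a.elim⟩

theorem plain_eq_iff {X Y : HTop.{u} Empty} {f g : C(X.carrier, Y.carrier)} :
    toHom (Map.plain f) = toHom (Map.plain g) ↔ f.Homotopic g := by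
  rw [toHom_eq_iff]
  exact ⟨fun ⟨F⟩ => ⟨F.toHomotopy⟩, fun ⟨F⟩ => ⟨⟨F, fun _ _ ⟨a, _⟩ => a.elim⟩⟩⟩

theorem exists_plain_rep {X Y : HTop.{u} Empty} (f : X ⟶ Y) :
    ∃ f' : C(X.carrier, Y.carrier), toHom (Map.plain f') = f := by
  obtain ⟨f, rfl⟩ := exists_rep f
  exact ⟨f.1, rfl⟩

/-- The underlying free homotopy class of a homotopy class relative to the marked points. -/
def freeHom (f : X ⟶ Y) : X.free ⟶ Y.free :=
  Quotient.map (sa := mapSetoid X Y) (sb := mapSetoid X.free Y.free)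
    (fun f => Map.plain f.1)
    (fun _ _ ⟨F⟩ => ⟨⟨F.toHomotopy, fun _ _ ⟨a, _⟩ => a.elim⟩⟩) f

theorem freeHom_id (X : HTop.{u} A) : freeHom (𝟙 X) = 𝟙 X.free := rfl

theorem freeHom_comp (f : X ⟶ Y) (g : Y ⟶ Z) : freeHom (f ≫ g) = freeHom f ≫ freeHom g := by
  obtain ⟨f, rfl⟩ := exists_rep f
  obtain ⟨g, rfl⟩ := exists_rep g
  rfl

/-- Forgetting the marked points preserves isomorphisms. -/
def freeIso (e : X ≅ Y) : X.free ≅ Y.free where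
  hom := freeHom e.hom
  inv := freeHom e.inv
  hom_inv_id := by rw [← freeHom_comp, e.hom_inv_id, freeHom_id]
  inv_hom_id := by rw [← freeHom_comp, e.inv_hom_id, freeHom_id]

end HTop

/-! ### Pointed expansions are unpointed expansions -/

open HTop

theorem IsHPol.free {A : Type} {X : HTop.{u} A} (h : IsHPol X) : IsHPol X.free := by
  obtain ⟨V, K, b, ⟨e⟩⟩ := h
  exact ⟨V, K, Empty.elim, ⟨freeIso e⟩⟩

/-- The marked realization of a simplicial complex is an object of HPol. -/
theorem isHPol_realization {A : Type} {V : Type u} (K : AbstractSimplicialComplex V)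
    (b : A → Realization K) : IsHPol (⟨Realization K, b⟩ : HTop.{u} A) :=
  ⟨V, K, b, ⟨Iso.refl _⟩⟩

theorem IsHPol.exists_iso_space {P : HTop.{u} Empty} (h : IsHPol P) :
    ∃ (V : Type u) (K : AbstractSimplicialComplex V), Nonempty (P ≅ space (Realization K)) := by
  obtain ⟨V, K, b, e⟩ := h
  obtain rfl : b = Empty.elim := Subsingleton.elim _ _
  exact ⟨V, K, e⟩

/-- The underlying system of spaces of an inverse system of marked spaces. -/
def InvSys.free {A : Type} (S : InvSys.{u} (HTop.{u} A)) : InvSys.{u} (HTop.{u} Empty) where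
  Idx := S.Idx
  obj l := (S.obj l).free
  bond h := freeHom (S.bond h)
  bond_refl l := by rw [S.bond_refl, freeHom_id]
  bond_comp h h' := by rw [← freeHom_comp, S.bond_comp]

/-- The underlying morphism of spaces. -/
def ToSys.free {A : Type} {X : HTop.{u} A} {S : InvSys.{u} (HTop.{u} A)} (p : ToSys X S) :
    ToSys X.free S.free where
  proj l := freeHom (p.proj l)
  proj_bond h := (freeHom_comp _ _).symm.trans (congrArg freeHom (p.proj_bond h))

/-- Two maps into a polyhedron that become freely homotopic along a pointed expansion are freely
homotopic at a later stage. -/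
theorem exists_bond_homotopic {X : HTop.{u} Unit} {S : InvSys.{u} (HTop.{u} Unit)} {p : ToSys X S}
    (hp : IsHPolExpansion p) {V : Type u} (K : AbstractSimplicialComplex V) (l : S.Idx)
    (f₀ f₁ : (S.obj l).free ⟶ space (Realization K))
    (h : freeHom (p.proj l) ≫ f₀ = freeHom (p.proj l) ≫ f₁) :
    ∃ (l' : S.Idx) (hl : l ≤ l'), freeHom (S.bond hl) ≫ f₀ = freeHom (S.bond hl) ≫ f₁ := by
  obtain ⟨f₀, rfl⟩ := exists_plain_rep f₀
  obtain ⟨f₁, rfl⟩ := exists_plain_rep f₁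
  obtain ⟨π, hπ⟩ := exists_rep (p.proj l)
  rw [← hπ] at h
  obtain ⟨H⟩ : (f₀.comp π.1).Homotopic (f₁.comp π.1) := plain_eq_iff.1 h
  obtain ⟨D, hD, hr⟩ := MetricRealization.exists_slide (X.pt ()) ((ContinuousMap.Homotopy.refl (toMetric K)).comp H)
  let θ := MetricRealization.toWeak K
  let ι := toMetric K
  -- The base point is the image of that of `S.obj l` under `θ ∘ ι ∘ f₁`. By `hbase`, `θ ∘ D ∘ ι ∘
  -- f₀` respects it as well, so pointed (E2) applies to this pair.
  let Q : HTop.{u} Unit := ⟨Realization K, fun _ => θ (ι (f₁ ((S.obj l).pt ())))⟩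
  have hbase : D (ι (f₀ ((S.obj l).pt ()))) = ι (f₁ ((S.obj l).pt ())) := by
    rw [← π.2 ()]
    obtain ⟨R⟩ := hr
    exact (R.fst_eq_snd (x := X.pt ()) rfl)
  let m₀ : Map (S.obj l) Q := ⟨θ.comp (D.comp (ι.comp f₀)), fun _ => congrArg θ hbase⟩
  let m₁ : Map (S.obj l) Q := ⟨θ.comp (ι.comp f₁), fun _ => rfl⟩
  have hm : p.proj l ≫ toHom m₀ = p.proj l ≫ toHom m₁ := by
    rw [← hπ]
    refine toHom_eq_iff.2 ?_
    obtain ⟨R⟩ := hr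
    have : range X.pt = {X.pt ()} := range_unique
    rw [this]
    exact ⟨R.compContinuousMap θ⟩
  obtain ⟨l', hl, hb⟩ := hp.e2 Q (isHPol_realization K _) l _ _ hm
  refine ⟨l', hl, ?_⟩
  have hθι := toWeak_comp_toMetric_homotopic K
  -- Freely, `D` and `θ ∘ ι` are homotopic to identities, so the modified maps represent the
  -- original classes.
  have h₀ : freeHom (toHom m₀) = toHom (Map.plain f₀) := plain_eq_iff.2
    (((ContinuousMap.Homotopic.refl θ).comp
      (hD.comp (ContinuousMap.Homotopic.refl (ι.comp f₀)))).trans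
      (hθι.comp (ContinuousMap.Homotopic.refl f₀)))
  have h₁ : freeHom (toHom m₁) = toHom (Map.plain f₁) := plain_eq_iff.2
    (hθι.comp (ContinuousMap.Homotopic.refl f₁))
  have := congrArg freeHom hb
  rwa [freeHom_comp, freeHom_comp, h₀, h₁] at this

/-- An HPol_*-expansion of a pointed space is an HPol-expansion of the underlying space. -/
theorem IsHPolExpansion.free {X : HTop.{u} Unit} {S : InvSys.{u} (HTop.{u} Unit)} {p : ToSys X S}
    (hp : IsHPolExpansion p) : IsHPolExpansion p.free where
  mem l := (hp.mem l).free
  e1 P hP h := by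
    obtain ⟨V, K, ⟨e⟩⟩ := hP.exists_iso_space
    obtain ⟨h', hh'⟩ := exists_plain_rep (h ≫ e.hom)
    -- Any point of a realization may be marked, so the image of the base point makes `h'` a pointed
    -- map.
    let Q : HTop.{u} Unit := ⟨Realization K, fun _ => h' (X.pt ())⟩
    obtain ⟨l, f, hf⟩ := hp.e1 Q (isHPol_realization K _) (toHom ⟨h', fun _ => rfl⟩)
    refine ⟨l, freeHom f ≫ e.inv, ?_⟩
    have := congrArg freeHom hf
    rw [freeHom_comp] at this
    change freeHom (p.proj l) ≫ freeHom f ≫ e.inv = h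
    refine (Category.assoc _ _ _).symm.trans ?_
    rw [this]
    exact (Iso.comp_inv_eq e).2 hh'
  e2 P hP l f₀ f₁ h := by
    obtain ⟨V, K, ⟨e⟩⟩ := hP.exists_iso_space
    obtain ⟨l', hl, hb⟩ := exists_bond_homotopic hp K l (f₀ ≫ e.hom) (f₁ ≫ e.hom)
      ((Category.assoc _ _ _).symm.trans
        ((congrArg (· ≫ e.hom) h).trans (Category.assoc _ _ _)))
    refine ⟨l', hl, (cancel_mono e.hom).1 ?_⟩
    exact (Category.assoc _ _ _).trans (hb.trans (Category.assoc _ _ _).symm)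

/-! ### Freely nullhomotopic spheres -/

section Cube

variable {k : ℕ}

/-- Stretch the cube away from its centre, coordinatewise, and truncate. -/
def stretch (r : I) (y : Fin k → I) : Fin k → I := fun i =>
  projIcc 0 1 zero_le_one ((1 + (r : ℝ)) * (y i : ℝ) - (r : ℝ) / 2)

theorem continuous_stretch : Continuous fun x : I × (Fin k → I) => stretch x.1 x.2 := by
  unfold stretch
  exact continuous_pi fun i => continuous_projIcc.comp (by fun_prop)

theorem stretch_zero (y : Fin k → I) : stretch 0 y = y := by
  funext i
  simp [stretch]

theorem stretch_mem_boundary (r : I) {y : Fin k → I} (hy : y ∈ Cube.boundary (Fin k)) :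
    stretch r y ∈ Cube.boundary (Fin k) := by
  have := r.2.1
  obtain ⟨i, hi | hi⟩ := hy
  · exact ⟨i, Or.inl (projIcc_of_le_left _ (by rw [hi, Icc.coe_zero]; linarith))⟩
  · exact ⟨i, Or.inr (projIcc_of_right_le _ (by rw [hi, Icc.coe_one]; linarith))⟩

/-- A function on the cube that vanishes on the boundary and equals `1` away from a collar. -/
def collar (y : Fin k → I) : I :=
  ∏ i, projIcc 0 1 zero_le_one (min (4 * (y i : ℝ)) (4 * (1 - (y i : ℝ))))

theorem continuous_collar : Continuous (collar (k := k)) := by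
  unfold collar
  exact continuous_finsetProd _ fun i _ => continuous_projIcc.comp (by fun_prop)

theorem collar_eq_zero {y : Fin k → I} (hy : y ∈ Cube.boundary (Fin k)) : collar y = 0 := by
  obtain ⟨i, hi⟩ := hy
  refine Finset.prod_eq_zero (Finset.mem_univ i) (projIcc_of_le_left _ ?_)
  rcases hi with hi | hi <;> simp [hi]

/-- At `r = 1` the stretch is `2 y - 1 / 2` truncated, which reaches an end for coordinates outside
`(1/4, 3/4)`; the factors of `collar` equal `1` on `[1/4, 3/4]`. -/
theorem collar_eq_one_or (y : Fin k → I) :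
    collar y = 1 ∨ stretch 1 y ∈ Cube.boundary (Fin k) := by
  by_contra! h
  refine h.1 (Finset.prod_eq_one fun i _ => projIcc_of_right_le _ ?_)
  by_contra! hi
  refine h.2 ⟨i, ?_⟩
  rcases min_lt_iff.1 hi with hi | hi
  · exact Or.inl (projIcc_of_le_left _ (by rw [Icc.coe_one]; linarith))
  · exact Or.inr (projIcc_of_right_le _ (by rw [Icc.coe_one]; linarith))

/-- A generalized loop that contracts to the base point through maps that are constant on the
boundary of the cube is null-homotopic. -/
theorem genLoop_homotopic_const_of_free [NeZero k] {X : Type u} [TopologicalSpace X] {x : X}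
    (g : GenLoop (Fin k) X x) (N : C(I × (Fin k → I), X)) (h0 : ∀ y, N (0, y) = g y)
    (h1 : ∀ y, N (1, y) = x)
    (hb : ∀ t, ∀ y ∈ Cube.boundary (Fin k), N (t, y) = N (t, 0)) :
    GenLoop.Homotopic g GenLoop.const := by
  have hx : N (0, 0) = x := (h0 0).trans (g.2 0 (CubeSphere.zero_mem_boundary k))
  have hN0 (y) (hy : y ∈ Cube.boundary (Fin k)) : N (0, y) = x := (hb 0 y hy).trans hx
  have s1 (y) (hy : y ∈ Cube.boundary (Fin k)) := stretch_mem_boundary 1 hy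
  -- The loop is first stretched, so that a collar goes to the base point (`a`). The free
  -- contraction is then run only up to time `collar y`, which keeps the boundary fixed and ends at
  -- `b`, a map that sees only the track of the boundary. Shortening that track to its start gives
  -- the constant map.
  let a : C(Fin k → I, X) := ⟨fun y => N (0, stretch 1 y),
    N.continuous.comp (continuous_const.prodMk (continuous_stretch.comp
      (Continuous.prodMk_right 1)))⟩
  let b : C(Fin k → I, X) := ⟨fun y => N (collar y, 0),
    N.continuous.comp (continuous_collar.prodMk continuous_const)⟩
  have hga : g.1.HomotopicRel a (Cube.boundary (Fin k)) := by
    refine ⟨⟨⟨⟨fun z => N (0, stretch z.1 z.2),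
      N.continuous.comp (continuous_const.prodMk continuous_stretch)⟩, ?_, ?_⟩, ?_⟩⟩
    · intro y
      exact (congrArg (fun y => N (0, y)) (stretch_zero y)).trans (h0 y)
    · exact fun y => rfl
    · intro t y hy
      exact (hN0 _ (stretch_mem_boundary t hy)).trans (g.2 y hy).symm
  have hab : a.HomotopicRel b (Cube.boundary (Fin k)) := by
    refine ⟨⟨⟨⟨fun z => N (z.1 * collar z.2, stretch 1 z.2), N.continuous.comp
      ((continuous_fst.mul (continuous_collar.comp continuous_snd)).prodMk
        (continuous_stretch.comp (continuous_const.prodMk continuous_snd)))⟩, ?_, ?_⟩, ?_⟩⟩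
    · intro y
      exact congrArg (fun t => N (t, stretch 1 y)) (zero_mul _)
    · intro y
      refine (congrArg (fun t => N (t, stretch 1 y)) (one_mul _)).trans ?_
      -- Either the contraction is complete, or the stretched point is on the boundary, where `N`
      -- depends only on time.
      rcases collar_eq_one_or y with h | h
      · change N (collar y, stretch 1 y) = N (collar y, 0)
        rw [h, h1, h1]
      · exact hb _ _ h
    · intro t y hy
      change N (t * collar y, _) = N (0, _)
      rw [collar_eq_zero hy, mul_zero]
  have hbc : ContinuousMap.HomotopicRel (GenLoop.const (N := Fin k) (x := x)).1 b
      (Cube.boundary (Fin k)) := by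
    refine ⟨⟨⟨⟨fun z => N (z.1 * collar z.2, 0), N.continuous.comp
      ((continuous_fst.mul (continuous_collar.comp continuous_snd)).prodMk
        continuous_const)⟩, ?_, ?_⟩, ?_⟩⟩
    · intro y
      exact (congrArg (fun t => N (t, 0)) (zero_mul _)).trans hx
    · intro y
      exact congrArg (fun t => N (t, 0)) (one_mul _)
    · intro t y hy
      change N (t * collar y, 0) = x
      rw [collar_eq_zero hy, mul_zero, hx]
  exact (hga.trans hab).trans hbc.symm

end Cube

/-! ### Pointed and free null-homotopies of sphere maps -/

section SphereMaps

variable {k : ℕ} [NeZero k] {P : HTop.{u} Unit}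

theorem sphereHom_one_eq : (1 : sphere.{u} k ⟶ P) =
    toHom ⟨ContinuousMap.const _ (P.pt ()), fun _ => rfl⟩ := by
  have : sphereHomEquiv (1 : sphere.{u} k ⟶ P) = 1 :=
    sphereHomEquiv.apply_symm_apply 1
  rw [← sphereHomEquiv.apply_eq_iff_eq, this, HomotopyGroup.one_def]
  rfl

theorem sphereHom_comp_const {Q : HTop.{u} Unit} (a : sphere.{u} k ⟶ P) :
    a ≫ toHom (Y := Q) ⟨ContinuousMap.const _ (Q.pt ()), fun _ => rfl⟩ = 1 := by
  obtain ⟨a, rfl⟩ := exists_rep a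
  rw [sphereHom_one_eq]
  rfl

/-- A pointed map of the sphere that is freely null-homotopic is null-homotopic as a pointed
map. -/
theorem sphereHom_eq_one_of_free {a : sphere.{u} k ⟶ P}
    (h : freeHom a = freeHom (1 : sphere.{u} k ⟶ P)) : a = 1 := by
  obtain ⟨f, rfl⟩ := exists_rep a
  rw [sphereHom_one_eq] at h
  obtain ⟨N⟩ : f.1.Homotopic (ContinuousMap.const _ (P.pt ())) := plain_eq_iff.1 h
  have hg : GenLoop.Homotopic (toGenLoop f) GenLoop.const := by
    refine genLoop_homotopic_const_of_free _ ⟨fun z => N (z.1, ⟨CubeSphere.mk k z.2⟩),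
      N.continuous.comp (continuous_fst.prodMk
      (continuous_uliftUp.comp ((CubeSphere.mk k).continuous.comp continuous_snd)))⟩ ?_ ?_ ?_
    · exact fun y => N.apply_zero _
    · exact fun y => N.apply_one _
    · intro t y hy
      have : CubeSphere.mk k y = CubeSphere.mk k 0 :=
        Quotient.sound (Or.inr ⟨hy, CubeSphere.zero_mem_boundary k⟩)
      exact congrArg (fun s => N (t, ⟨s⟩)) this
  have : sphereHomEquiv (1 : sphere.{u} k ⟶ P) = 1 :=
    sphereHomEquiv.apply_symm_apply 1
  rw [← sphereHomEquiv.apply_eq_iff_eq, this, HomotopyGroup.one_def]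
  exact Quotient.sound hg

end SphereMaps

open HTop Filter

/-! ### Products of marked spaces -/

namespace HTop

variable {A : Type} {X Y Z W : HTop.{u} A}

/-- The first projection of a product. -/
def fst (X Y : HTop.{u} A) : X.prod Y ⟶ X := toHom ⟨ContinuousMap.fst, fun _ => rfl⟩

/-- The second projection of a product. -/
def snd (X Y : HTop.{u} A) : X.prod Y ⟶ Y := toHom ⟨ContinuousMap.snd, fun _ => rfl⟩

/-- The pairing of two maps. -/
def Map.lift (f : Map Z X) (g : Map Z Y) : Map Z (X.prod Y) :=
  ⟨f.1.prodMk g.1, fun a => Prod.ext (f.2 a) (g.2 a)⟩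

/-- The pairing of two homotopy classes. -/
def lift (f : Z ⟶ X) (g : Z ⟶ Y) : Z ⟶ X.prod Y :=
  Quotient.map₂ (sa := mapSetoid _ _) (sb := mapSetoid _ _) (sc := mapSetoid _ _) Map.lift
    (fun _ _ ⟨F⟩ _ _ ⟨G⟩ => ⟨⟨F.toHomotopy.prodMk G.toHomotopy, fun t _ hx =>
      Prod.ext (F.eq_fst t hx) (G.eq_fst t hx)⟩⟩) f g

theorem comp_lift (h : W ⟶ Z) (f : Z ⟶ X) (g : Z ⟶ Y) :
    h ≫ lift f g = lift (h ≫ f) (h ≫ g) := by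
  obtain ⟨f, rfl⟩ := exists_rep f
  obtain ⟨g, rfl⟩ := exists_rep g
  obtain ⟨h, rfl⟩ := exists_rep h
  rfl

theorem lift_prodHom {X' Y' : HTop.{u} A} (f : Z ⟶ X) (g : Z ⟶ Y) (a : X ⟶ X') (b : Y ⟶ Y') :
    lift f g ≫ prodHom a b = lift (f ≫ a) (g ≫ b) := by
  obtain ⟨f, rfl⟩ := exists_rep f
  obtain ⟨g, rfl⟩ := exists_rep g
  obtain ⟨a, rfl⟩ := exists_rep a
  obtain ⟨b, rfl⟩ := exists_rep b
  rfl

/-- The class of the constant map between pointed spaces. -/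
def const (X Y : HTop.{u} Unit) : X ⟶ Y :=
  toHom ⟨ContinuousMap.const _ (Y.pt ()), fun _ => rfl⟩

theorem comp_const {X Y Z : HTop.{u} Unit} (f : X ⟶ Y) : f ≫ const Y Z = const X Z := by
  obtain ⟨f, rfl⟩ := exists_rep f
  rfl

theorem const_comp {X Y Z : HTop.{u} Unit} (f : Y ⟶ Z) : const X Y ≫ f = const X Z := by
  obtain ⟨f, rfl⟩ := exists_rep f
  refine congrArg toHom (Subtype.ext (ContinuousMap.ext fun _ => f.2 ()))

/-- The inclusion of the first factor at the base point of the second. -/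
def inl (X Y : HTop.{u} Unit) : X ⟶ X.prod Y := lift (𝟙 X) (const X Y)

/-- The inclusion of the second factor at the base point of the first. -/
def inr (X Y : HTop.{u} Unit) : Y ⟶ X.prod Y := lift (const Y X) (𝟙 Y)

theorem inl_fst (X Y : HTop.{u} Unit) : inl X Y ≫ fst X Y = 𝟙 X := rfl
theorem inl_snd (X Y : HTop.{u} Unit) : inl X Y ≫ snd X Y = const X Y := rfl
theorem inr_fst (X Y : HTop.{u} Unit) : inr X Y ≫ fst X Y = const Y X := rfl
theorem inr_snd (X Y : HTop.{u} Unit) : inr X Y ≫ snd X Y = 𝟙 Y := rfl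

end HTop

/-! ### Coarse shape homotopy groups as limits of groups of germs -/

section Germs

variable {k : ℕ} [NeZero k] {P Q W : HTop.{u} Unit}

/-- Germs at infinity of sequences of elements of a homotopy group. -/
abbrev SphereGerm (k : ℕ) (P : HTop.{u} Unit) : Type u :=
  Germ (atTop : Filter ℕ) (sphere.{u} k ⟶ P)

/-- Composition of germs with a homotopy class. -/
def SphereGerm.map (g : P ⟶ Q) : SphereGerm k P →* SphereGerm k Q where
  toFun := Germ.map (· ≫ g)
  map_one' := congrArg _ (funext fun _ : ℕ => sphereHom_one_comp g)
  map_mul' a b := by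
    induction a using Germ.inductionOn
    induction b using Germ.inductionOn
    exact congrArg _ (funext fun _ => sphereHom_mul_comp _ _ g)

theorem SphereGerm.map_map (g : P ⟶ Q) (h : Q ⟶ W) (a : SphereGerm k P) :
    SphereGerm.map h (SphereGerm.map g a) = SphereGerm.map (g ≫ h) a := by
  induction a using Germ.inductionOn
  exact congrArg _ (funext fun _ => Category.assoc _ _ _)

theorem SphereGerm.map_id (a : SphereGerm k P) : SphereGerm.map (𝟙 P) a = a := by
  induction a using Germ.inductionOn
  exact congrArg _ (funext fun _ => Category.comp_id _)

theorem SphereGerm.map_const (a : SphereGerm k P) : SphereGerm.map (const P Q) a = 1 := by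
  induction a using Germ.inductionOn
  exact congrArg _ (funext fun _ => sphereHom_comp_const _)

namespace CoarseHomotopyGroup

variable {X Y Z : HTop.{u} Unit} {S T R : InvSys.{u} (HTop.{u} Unit)}
  {p : ToSys X S} {q : ToSys Y T} {r : ToSys Z R}

/-- The germ at infinity of the sequence of terms at a given index. -/
def germ (p : ToSys X S) (μ : S.Idx) : CoarseHomotopyGroup k p →* SphereGerm k (S.obj μ) where
  toFun := Quotient.lift (s := SStarMor.setoid _ _)
    (fun f => ((fun n => term f n μ : ℕ → _) : SphereGerm k (S.obj μ)))
    fun f g h => Germ.coe_eq.2 (eventually_atTop.2 ((equiv_iff f g).1 h μ))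
  map_one' := rfl
  map_mul' a b := by
    obtain ⟨a, rfl⟩ := Quotient.exists_rep a
    obtain ⟨b, rfl⟩ := Quotient.exists_rep b
    rfl

/-- Equality for all large `n` is equality of germs. With `map_bond_germ` and `exists_germ_eq` this
identifies the group with the inverse limit of the germ groups. -/
theorem ext_germ {F G : CoarseHomotopyGroup k p} (h : ∀ μ, germ p μ F = germ p μ G) : F = G := by
  obtain ⟨f, rfl⟩ := Quotient.exists_rep F
  obtain ⟨g, rfl⟩ := Quotient.exists_rep G
  exact Quotient.sound ((equiv_iff f g).2 fun μ => eventually_atTop.1 (Germ.coe_eq.1 (h μ)))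

theorem map_bond_germ {μ μ' : S.Idx} (h : μ ≤ μ') (F : CoarseHomotopyGroup k p) :
    SphereGerm.map (S.bond h) (germ p μ' F) = germ p μ F := by
  obtain ⟨f, rfl⟩ := Quotient.exists_rep F
  exact Germ.coe_eq.2 (eventually_atTop.2 (term_compat f h))

theorem exists_germ_eq (p : ToSys X S) (c : ∀ μ, SphereGerm k (S.obj μ))
    (hc : ∀ {μ μ' : S.Idx} (h : μ ≤ μ'), SphereGerm.map (S.bond h) (c μ') = c μ) :
    ∃ F : CoarseHomotopyGroup k p, ∀ μ, germ p μ F = c μ := by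
  -- Representatives may be chosen independently for each index, since compatibility is required
  -- only for large `n`, with a bound depending on the pair of indices.
  choose t ht using fun μ => Quotient.exists_rep (c μ)
  refine ⟨Quotient.mk (SStarMor.setoid _ _) (ofTerms (fun n μ => t μ n) fun {μ μ'} h => ?_), ht⟩
  have := hc h
  rw [← ht, ← ht] at this
  exact eventually_atTop.1 (Germ.coe_eq.1 this)

/-- The basic open sets are the fibres of the germ maps, so the topology is the initial one for
these maps to discrete groups; the next two lemmas are its two halves. -/
theorem nbhd_eq (F : CoarseHomotopyGroup k p) (μ : S.Idx) :
    nbhd p F μ = germ p μ ⁻¹' {germ p μ F} := by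
  ext G
  obtain ⟨f, rfl⟩ := Quotient.exists_rep F
  obtain ⟨g, rfl⟩ := Quotient.exists_rep G
  refine (Quotient.eq (r := SStarMor.setoid _ _)).trans (Iff.trans ?_ eq_comm)
  refine Iff.trans ((equiv_iff (f.proj μ) (g.proj μ)).trans ⟨fun h => h PUnit.unit,
    fun h _ => h⟩) (Iff.trans eventually_atTop.symm Germ.coe_eq.symm)

theorem isLocallyConstant_germ (p : ToSys X S) (μ : S.Idx) :
    IsLocallyConstant (germ (k := k) p μ) := by
  refine (IsLocallyConstant.iff_exists_open _).2 fun F => ⟨nbhd p F μ, ?_, ?_, ?_⟩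
  · exact TopologicalSpace.isOpen_generateFrom_of_mem ⟨F, μ, rfl⟩
  · rw [nbhd_eq]
    rfl
  · rw [nbhd_eq]
    exact fun _ h => h

theorem continuous_of_germ {A : Type*} [TopologicalSpace A] {f : A → CoarseHomotopyGroup k p}
    (h : ∀ μ, IsLocallyConstant fun a => germ p μ (f a)) : Continuous f := by
  refine continuous_generateFrom_iff.2 ?_
  rintro _ ⟨F, μ, rfl⟩
  rw [nbhd_eq]
  exact h μ _

/-! ### Evaluation on maps to HPol_* and functoriality -/

/-- By (E2) two factorizations of one map agree at a later index, and germs are compatible with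
bonding maps. Hence `eval` does not depend on the chosen factorization. -/
theorem map_germ_eq (hp : IsHPolExpansion p) (hP : IsHPol P) {μ μ' : S.Idx} {g : S.obj μ ⟶ P}
    {g' : S.obj μ' ⟶ P} (h : p.proj μ ≫ g = p.proj μ' ≫ g') (F : CoarseHomotopyGroup k p) :
    SphereGerm.map g (germ p μ F) = SphereGerm.map g' (germ p μ' F) := by
  obtain ⟨l, h₁, h₂⟩ := exists_ge_ge μ μ'
  obtain ⟨l', h₃, h₄⟩ := hp.e2 P hP l (S.bond h₁ ≫ g) (S.bond h₂ ≫ g') (by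
    rw [← Category.assoc, p.proj_bond, ← Category.assoc, p.proj_bond, h])
  rw [← map_bond_germ h₁ F, ← map_bond_germ h₂ F, SphereGerm.map_map, SphereGerm.map_map,
    ← map_bond_germ h₃ F, SphereGerm.map_map, SphereGerm.map_map, h₄]

/-- The homomorphism induced by a map into an object of HPol_*. -/
def eval (hp : IsHPolExpansion p) (hP : IsHPol P) (φ : X ⟶ P) :
    CoarseHomotopyGroup k p →* SphereGerm k P :=
  (SphereGerm.map (hp.e1 P hP φ).choose_spec.choose).comp (germ p (hp.e1 P hP φ).choose)

theorem eval_eq (hp : IsHPolExpansion p) (hP : IsHPol P) {φ : X ⟶ P} {μ : S.Idx}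
    {g : S.obj μ ⟶ P} (h : p.proj μ ≫ g = φ) (F : CoarseHomotopyGroup k p) :
    eval hp hP φ F = SphereGerm.map g (germ p μ F) :=
  map_germ_eq hp hP ((hp.e1 P hP φ).choose_spec.choose_spec.trans h.symm) F

theorem map_eval (hp : IsHPolExpansion p) (hP : IsHPol P) (hQ : IsHPol Q) (φ : X ⟶ P) (g : P ⟶ Q)
    (F : CoarseHomotopyGroup k p) :
    SphereGerm.map g (eval hp hP φ F) = eval hp hQ (φ ≫ g) F := by
  obtain ⟨μ, f, hf⟩ := hp.e1 P hP φ
  rw [eval_eq hp hP hf, eval_eq hp hQ (g := f ≫ g) (by rw [← Category.assoc, hf]),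
    SphereGerm.map_map]

theorem eval_proj (hp : IsHPolExpansion p) (μ : S.Idx) (F : CoarseHomotopyGroup k p) :
    eval hp (hp.mem μ) (p.proj μ) F = germ p μ F := by
  rw [eval_eq hp (hp.mem μ) (Category.comp_id _), SphereGerm.map_id]

theorem eval_const (hp : IsHPolExpansion p) (hP : IsHPol P) (F : CoarseHomotopyGroup k p) :
    eval hp hP (const X P) F = 1 := by
  rw [eval_eq hp hP (comp_const (p.proj (Classical.arbitrary S.Idx))), SphereGerm.map_const]

theorem isLocallyConstant_eval (hp : IsHPolExpansion p) (hP : IsHPol P) (φ : X ⟶ P) :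
    IsLocallyConstant (eval (k := k) hp hP φ) :=
  (isLocallyConstant_germ p _).comp _

theorem exists_germ_eq_eval (hp : IsHPolExpansion p) (hq : IsHPolExpansion q) (φ : X ⟶ Y)
    (F : CoarseHomotopyGroup k p) : ∃ G : CoarseHomotopyGroup k q,
      ∀ μ, germ q μ G = eval hp (hq.mem μ) (φ ≫ q.proj μ) F :=
  exists_germ_eq q _ fun {μ μ'} h => by
    rw [map_eval hp (hq.mem μ') (hq.mem μ), Category.assoc, q.proj_bond]

/-- The homomorphism of coarse shape homotopy groups induced by a pointed homotopy class. -/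
def induced (hp : IsHPolExpansion p) (hq : IsHPolExpansion q) (φ : X ⟶ Y) :
    CoarseHomotopyGroup k p →* CoarseHomotopyGroup k q :=
  MonoidHom.mk' (fun F => (exists_germ_eq_eval hp hq φ F).choose) fun F G => ext_germ fun μ => by
    rw [map_mul, (exists_germ_eq_eval hp hq φ _).choose_spec,
      (exists_germ_eq_eval hp hq φ _).choose_spec, (exists_germ_eq_eval hp hq φ _).choose_spec,
      map_mul]

theorem germ_induced (hp : IsHPolExpansion p) (hq : IsHPolExpansion q) (φ : X ⟶ Y)
    (F : CoarseHomotopyGroup k p) (μ : T.Idx) :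
    germ q μ (induced hp hq φ F) = eval hp (hq.mem μ) (φ ≫ q.proj μ) F :=
  (exists_germ_eq_eval hp hq φ F).choose_spec μ

theorem eval_induced (hp : IsHPolExpansion p) (hq : IsHPolExpansion q) (hP : IsHPol P) (φ : X ⟶ Y)
    (ψ : Y ⟶ P) (F : CoarseHomotopyGroup k p) :
    eval hq hP ψ (induced hp hq φ F) = eval hp hP (φ ≫ ψ) F := by
  obtain ⟨μ, g, rfl⟩ := hq.e1 P hP ψ
  rw [eval_eq hq hP rfl, germ_induced, map_eval hp (hq.mem μ) hP, Category.assoc]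

theorem induced_induced (hp : IsHPolExpansion p) (hq : IsHPolExpansion q)
    (hr : IsHPolExpansion r) (φ : X ⟶ Y) (ψ : Y ⟶ Z) (F : CoarseHomotopyGroup k p) :
    induced hq hr ψ (induced hp hq φ F) = induced hp hr (φ ≫ ψ) F :=
  ext_germ fun μ => by
    rw [germ_induced, germ_induced, eval_induced hp hq (hr.mem μ), Category.assoc]

theorem induced_id (hp : IsHPolExpansion p) (F : CoarseHomotopyGroup k p) :
    induced hp hp (𝟙 X) F = F :=
  ext_germ fun μ => by
    rw [germ_induced, ← eval_proj hp]
    congr 2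
    exact Category.id_comp _

theorem induced_const (hp : IsHPolExpansion p) (hq : IsHPolExpansion q)
    (F : CoarseHomotopyGroup k p) : induced hp hq (const X Y) F = 1 :=
  ext_germ fun μ => by
    rw [germ_induced, map_one, const_comp, eval_const]

theorem continuous_induced (hp : IsHPolExpansion p) (hq : IsHPolExpansion q) (φ : X ⟶ Y) :
    Continuous (induced (k := k) hp hq φ) :=
  continuous_of_germ fun μ => by
    simp only [germ_induced]
    exact isLocallyConstant_eval hp _ _

theorem continuous_mul (p : ToSys X S) :
    Continuous fun x : CoarseHomotopyGroup k p × CoarseHomotopyGroup k p => x.1 * x.2 :=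
  continuous_of_germ fun μ => by
    simp only [map_mul]
    exact ((isLocallyConstant_germ p μ).comp_continuous continuous_fst).mul
      ((isLocallyConstant_germ p μ).comp_continuous continuous_snd)

/-! ### The coarse shape homotopy groups of a product -/

/-- If the product of the unpointed spaces has a product expansion, every term of a pointed
expansion of the product depends, up to free homotopy, only on terms of pointed expansions of the
factors. -/
theorem exists_lift_comp_eq {X Y : HTop.{u} Unit} {p : ToSys X S} {q : ToSys Y T}
    {S' T' : InvSys.{u} (HTop.{u} Empty)} {p' : ToSys X.free S'} {q' : ToSys Y.free T'}
    (hp' : IsHPolExpansion p') (hq' : IsHPolExpansion q') (hpq' : IsHPolExpansion (p'.prod q'))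
    (hp : IsHPolExpansion p) (hq : IsHPolExpansion q) {P : HTop.{u} Empty} (hP : IsHPol P)
    (h : (X.prod Y).free ⟶ P) :
    ∃ (l : S.Idx) (m : T.Idx) (f : (S.obj l).free.prod (T.obj m).free ⟶ P),
      lift (freeHom (fst X Y ≫ p.proj l)) (freeHom (snd X Y ≫ q.proj m)) ≫ f = h := by
  -- Forgetting base points and taking products commute; `c` and `d` pass between the two forms of
  -- the same space.
  let c : (X.prod Y).free ⟶ X.free.prod Y.free := lift (freeHom (fst X Y)) (freeHom (snd X Y))
  let d : X.free.prod Y.free ⟶ (X.prod Y).free := toHom (Map.plain (ContinuousMap.id _))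
  have hcd : c ≫ d = 𝟙 _ := rfl
  obtain ⟨a, b, f, hf⟩ : ∃ (a : S'.Idx) (b : T'.Idx) (f : (S'.obj a).prod (T'.obj b) ⟶ P),
      prodHom (p'.proj a) (q'.proj b) ≫ f = d ≫ h := by
    obtain ⟨⟨a, b⟩, f, hf⟩ := hpq'.e1 P hP (d ≫ h)
    exact ⟨a, b, f, hf⟩
  -- Here the pointed expansions are used as unpointed ones, to factor the terms of `p'` and `q'`.
  obtain ⟨l, α, hα⟩ : ∃ (l : S.Idx) (α : (S.obj l).free ⟶ S'.obj a),
      freeHom (p.proj l) ≫ α = p'.proj a := hp.free.e1 _ (hp'.mem a) (p'.proj a)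
  obtain ⟨m, β, hβ⟩ : ∃ (m : T.Idx) (β : (T.obj m).free ⟶ T'.obj b),
      freeHom (q.proj m) ≫ β = q'.proj b := hq.free.e1 _ (hq'.mem b) (q'.proj b)
  refine ⟨l, m, prodHom α β ≫ f, ?_⟩
  have h₁ : lift (freeHom (fst X Y ≫ p.proj l)) (freeHom (snd X Y ≫ q.proj m)) ≫ prodHom α β =
      c ≫ prodHom (p'.proj a) (q'.proj b) := by
    rw [lift_prodHom, lift_prodHom, freeHom_comp, freeHom_comp, ← hα, ← hβ, Category.assoc,
      Category.assoc]
  calc _ = (lift (freeHom (fst X Y ≫ p.proj l)) (freeHom (snd X Y ≫ q.proj m)) ≫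
        prodHom α β) ≫ f := (Category.assoc _ _ _).symm
    _ = c ≫ prodHom (p'.proj a) (q'.proj b) ≫ f := by rw [h₁, Category.assoc]
    _ = c ≫ d ≫ h := congrArg (c ≫ ·) hf
    _ = h := by rw [← Category.assoc, hcd, Category.id_comp]

/-- The elements of the homotopy group of a late term of an expansion of the product that vanish in
suitable terms of the expansions of the factors vanish in a given earlier term. -/
theorem exists_bond_eq_one {X Y : HTop.{u} Unit} {p : ToSys X S} {q : ToSys Y T}
    {r : ToSys (X.prod Y) R}
    {S' T' : InvSys.{u} (HTop.{u} Empty)} {p' : ToSys X.free S'} {q' : ToSys Y.free T'}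
    (hp' : IsHPolExpansion p') (hq' : IsHPolExpansion q') (hpq' : IsHPolExpansion (p'.prod q'))
    (hp : IsHPolExpansion p) (hq : IsHPolExpansion q) (hr : IsHPolExpansion r) (ν : R.Idx) :
    ∃ (l : S.Idx) (m : T.Idx) (ν' : R.Idx) (hν : ν ≤ ν') (g₁ : R.obj ν' ⟶ S.obj l)
      (g₂ : R.obj ν' ⟶ T.obj m), r.proj ν' ≫ g₁ = fst X Y ≫ p.proj l ∧
      r.proj ν' ≫ g₂ = snd X Y ≫ q.proj m ∧
      ∀ a : sphere.{u} k ⟶ R.obj ν', a ≫ g₁ = 1 → a ≫ g₂ = 1 → a ≫ R.bond hν = 1 := by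
  obtain ⟨l, m, f, hf⟩ := exists_lift_comp_eq hp' hq' hpq' hp hq (hr.mem ν).free
    (freeHom (r.proj ν))
  obtain ⟨ν₁, g₁, hg₁⟩ := hr.e1 _ (hp.mem l) (fst X Y ≫ p.proj l)
  obtain ⟨ν₂, g₂, hg₂⟩ := hr.e1 _ (hq.mem m) (snd X Y ≫ q.proj m)
  obtain ⟨ν₁₂, h₁, h₂⟩ := exists_ge_ge ν₁ ν₂
  obtain ⟨ν₃, h₃, h₄⟩ := exists_ge_ge ν₁₂ ν
  have hp₁ : r.proj ν₃ ≫ R.bond (h₁.trans h₃) ≫ g₁ = fst X Y ≫ p.proj l := by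
    rw [← Category.assoc, r.proj_bond, hg₁]
  have hp₂ : r.proj ν₃ ≫ R.bond (h₂.trans h₃) ≫ g₂ = snd X Y ≫ q.proj m := by
    rw [← Category.assoc, r.proj_bond, hg₂]
  -- The free factorization of `r.proj ν` through the product of terms becomes, by unpointed (E2), a
  -- factorization of a bonding map.
  obtain ⟨ν', h₅, hb⟩ : ∃ (ν' : R.Idx) (h₅ : ν₃ ≤ ν'),
      freeHom (R.bond h₅) ≫ lift (freeHom (R.bond (h₁.trans h₃) ≫ g₁))
        (freeHom (R.bond (h₂.trans h₃) ≫ g₂)) ≫ f =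
      freeHom (R.bond h₅) ≫ freeHom (R.bond h₄) := hr.free.e2 (R.obj ν).free (hr.mem ν).free ν₃
    (lift (freeHom (R.bond (h₁.trans h₃) ≫ g₁)) (freeHom (R.bond (h₂.trans h₃) ≫ g₂)) ≫ f)
    (freeHom (R.bond h₄)) (by
      refine (Category.assoc _ _ _).symm.trans ?_
      refine (congrArg (· ≫ f) (comp_lift _ _ _)).trans ?_
      refine Eq.trans ?_ (r.free.proj_bond (l := ν) h₄).symm
      refine Eq.trans (congrArg (· ≫ f) (congrArg₂ lift ?_ ?_)) hf
      · exact (freeHom_comp _ _).symm.trans (congrArg freeHom hp₁)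
      · exact (freeHom_comp _ _).symm.trans (congrArg freeHom hp₂))
  rw [← Category.assoc, comp_lift, ← freeHom_comp, ← freeHom_comp, ← freeHom_comp,
    R.bond_comp] at hb
  refine ⟨l, m, ν', h₄.trans h₅, R.bond h₅ ≫ R.bond (h₁.trans h₃) ≫ g₁,
    R.bond h₅ ≫ R.bond (h₂.trans h₃) ≫ g₂, ?_, ?_, fun a ha₁ ha₂ => ?_⟩
  · rw [← Category.assoc, r.proj_bond, hp₁]
  · rw [← Category.assoc, r.proj_bond, hp₂]
  -- Since `f` need not respect base points, the right-hand side is not visibly the class of a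
  -- constant map at the base point; comparison with `b = 1` shows that it is the free class of the
  -- trivial element.
  have key (b : sphere.{u} k ⟶ R.obj ν')
      (hb₁ : b ≫ R.bond h₅ ≫ R.bond (h₁.trans h₃) ≫ g₁ = 1)
      (hb₂ : b ≫ R.bond h₅ ≫ R.bond (h₂.trans h₃) ≫ g₂ = 1) :
      freeHom (b ≫ R.bond (h₄.trans h₅)) = lift (freeHom 1) (freeHom 1) ≫ f := by
    rw [freeHom_comp, ← hb, ← Category.assoc, comp_lift, ← freeHom_comp, ← freeHom_comp, hb₁, hb₂]
  refine sphereHom_eq_one_of_free ?_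
  rw [key a ha₁ ha₂, ← key 1 (sphereHom_one_comp _) (sphereHom_one_comp _), sphereHom_one_comp]

/-- The coarse shape homotopy groups of a product, when the product of the unpointed spaces has a
product expansion. -/
theorem nonempty_prod_equiv {X Y : HTop.{u} Unit} {p : ToSys X S} {q : ToSys Y T}
    {r : ToSys (X.prod Y) R}
    {S' T' : InvSys.{u} (HTop.{u} Empty)} {p' : ToSys X.free S'} {q' : ToSys Y.free T'}
    (hp' : IsHPolExpansion p') (hq' : IsHPolExpansion q') (hpq' : IsHPolExpansion (p'.prod q'))
    (hp : IsHPolExpansion p) (hq : IsHPolExpansion q) (hr : IsHPolExpansion r) :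
    Nonempty (CoarseHomotopyGroup k r ≃ₜ*
      CoarseHomotopyGroup k p × CoarseHomotopyGroup k q) := by
  let Φ : CoarseHomotopyGroup k r →* CoarseHomotopyGroup k p × CoarseHomotopyGroup k q :=
    (induced hr hp (fst X Y)).prod (induced hr hq (snd X Y))
  let Ψ (x : CoarseHomotopyGroup k p × CoarseHomotopyGroup k q) : CoarseHomotopyGroup k r :=
    induced hp hr (inl X Y) x.1 * induced hq hr (inr X Y) x.2
  have hΦΨ (x) : Φ (Ψ x) = x := by
    refine Prod.ext ?_ ?_
    · change induced hr hp (fst X Y) (_ * _) = x.1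
      rw [map_mul, induced_induced, induced_induced, inl_fst, inr_fst, induced_id, induced_const,
        mul_one]
    · change induced hr hq (snd X Y) (_ * _) = x.2
      rw [map_mul, induced_induced, induced_induced, inl_snd, inr_snd, induced_id, induced_const,
        one_mul]
  -- Germwise: for large `n` the terms of `F` at `ν'` die in both factors, so their images at `ν`
  -- are trivial.
  have hΦ : Function.Injective Φ := by
    refine (injective_iff_map_eq_one Φ).2 fun F hF => ext_germ fun ν => ?_
    have hF₁ : induced hr hp (fst X Y) F = 1 := congrArg Prod.fst hF
    have hF₂ : induced hr hq (snd X Y) F = 1 := congrArg Prod.snd hF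
    obtain ⟨l, m, ν', hν, g₁, g₂, hg₁, hg₂, h⟩ :=
      exists_bond_eq_one (k := k) hp' hq' hpq' hp hq hr ν
    have h₁ := germ_induced hr hp (fst X Y) F l
    have h₂ := germ_induced hr hq (snd X Y) F m
    rw [hF₁, map_one, eval_eq hr (hp.mem l) hg₁] at h₁
    rw [hF₂, map_one, eval_eq hr (hq.mem m) hg₂] at h₂
    rw [map_one, ← map_bond_germ hν F]
    generalize germ r ν' F = c at h₁ h₂
    induction c using Germ.inductionOn with
    | h c =>
      refine Germ.coe_eq.2 ?_
      filter_upwards [Germ.coe_eq.1 h₁, Germ.coe_eq.1 h₂] with n hn₁ hn₂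
      exact h _ hn₁.symm hn₂.symm
  exact ⟨{ MulEquiv.mk' ⟨Φ, Ψ, fun F => hΦ (hΦΨ _), hΦΨ⟩ (map_mul Φ) with
    continuous_toFun := (continuous_induced hr hp _).prodMk (continuous_induced hr hq _)
    continuous_invFun := (continuous_mul r).comp
      (((continuous_induced hp hr _).comp continuous_fst).prodMk
        ((continuous_induced hq hr _).comp continuous_snd)) }⟩

end CoarseHomotopyGroup

end Germs

end CoarseShape

end

theorem theorem5p1 {X Y : Type u} [TopologicalSpace X] [TopologicalSpace Y]
    -- `X` and `Y` are coarse shape path connected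
    (_hX : CoarseShape.CoarseShapePathConnected X)
    (_hY : CoarseShape.CoarseShapePathConnected Y)
    -- they have HPol-expansions `p` and `q` such that `p × q` is an HPol-expansion of `X × Y`
    (_hpq : ∃ (S T : CoarseShape.InvSys.{u} (CoarseShape.HTop.{u} Empty))
      (p : CoarseShape.ToSys (CoarseShape.HTop.space X) S)
      (q : CoarseShape.ToSys (CoarseShape.HTop.space Y) T),
      CoarseShape.IsHPolExpansion p ∧ CoarseShape.IsHPolExpansion q ∧
        CoarseShape.IsHPolExpansion (p.prod q))
    -- arbitrary base points, and arbitrary HPol_*-expansions along which the coarse shape homotopy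
    -- groups of `(X, x)`, `(Y, y)` and `(X × Y, (x, y))` are computed
    (x : X) (y : Y)
    {S T R : CoarseShape.InvSys.{u} (CoarseShape.HTop.{u} Unit)}
    (p : CoarseShape.ToSys (CoarseShape.HTop.pointed X x) S)
    (q : CoarseShape.ToSys (CoarseShape.HTop.pointed Y y) T)
    (r : CoarseShape.ToSys (CoarseShape.HTop.pointed (X × Y) (x, y)) R)
    (_hp : CoarseShape.IsHPolExpansion p) (_hq : CoarseShape.IsHPolExpansion q)
    (_hr : CoarseShape.IsHPolExpansion r)
    (k : ℕ) [NeZero k] :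
    Nonempty (CoarseShape.CoarseHomotopyGroup k r ≃ₜ*
      CoarseShape.CoarseHomotopyGroup k p × CoarseShape.CoarseHomotopyGroup k q) := by
  obtain ⟨S', T', p', q', hp', hq', hpq'⟩ := _hpq
  -- The pointed product space and the underlying plain spaces agree by definition with those in the
  -- general statement.
  exact CoarseShape.CoarseHomotopyGroup.nonempty_prod_equiv (X := CoarseShape.HTop.pointed X x)
    (Y := CoarseShape.HTop.pointed Y y) hp' hq' hpq' _hp _hq _hr
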